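/- Let $A$ be an alphabet. A \emph{set partition} is a finite word $p = p_1p_2\cdots p_n$ of (possibly repeated) letters of $A$; $|p| = n$ is its length and $N(p)$ is the number of distinct letters occurring in it. It is \emph{sorted} if all occurrences of each letter are consecutive. Two set partitions $p = p_1\cdots p_n$ and $q = q_1\cdots q_n$ are \emph{equivalent} if $q = f(p_1)\cdots f(p_n)$ for some bijection $f : A \to A$. Fix distinct letters $a, b \in A$. The map $\phi_{aba}$ sends $p$ through an initially empty stack: at each step, if pushing the leftmost remaining input letter leaves a stack with no (not necessarily contiguous) subsequence equivalent to $aba$, that letter is pushed; otherwise the top of the stack is popped and appended to the output; when the input is exhausted, the stack is popped from top to bottom to the output. Then $\phi_{aba}(p)$ is the output word. Let $N \ge 3$ be an integer and suppose that $A$ has at least $N$ letters. Then the number of equivalence classes of set partitions $p$ with $N(p) = N$ and $|p| = 2N+1$ such that $\phi_{aba}^{N-1}(p)$ is not sorted is exactly $$\binom{N+1}{2} + 2\binom{N}{2}.$$ -/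

import Mathlib

namespace StackSort

universe u

variable {A : Type u}

/-- A set partition is a word `p = p₁ p₂ ⋯ pₙ` over the alphabet `A`. Two of them are equivalent if
a bijection of the alphabet carries one to the other. -/
def Equivalent (p q : List A) : Prop :=
  ∃ f : Equiv.Perm A, q = p.map f

/-- Equivalence of set partitions as a setoid; its classes are the set partitions up to
equivalence. -/
def equivSetoid (A : Type u) : Setoid (List A) where
  r := Equivalent
  iseqv :=
    { refl := fun p => ⟨Equiv.refl A, by simp⟩
      symm := by
        rintro p q ⟨f, rfl⟩
        exact ⟨f.symm, by simp⟩
      trans := by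
        rintro p q r ⟨f, rfl⟩ ⟨g, rfl⟩
        exact ⟨f.trans g, by simp⟩ }

/-- `numLetters p` is `N(p)`, the number of distinct letters that occur in `p`. -/
noncomputable def numLetters (p : List A) : ℕ :=
  {a : A | a ∈ p}.ncard

/-- All occurrences of the same letter are consecutive. -/
def IsSorted (p : List A) : Prop :=
  ∀ i j k : ℕ, ∀ (hij : i < j) (hjk : j < k) (hk : k < p.length),
    p[i] = p[k] → p[j] = p[i]

/-- The stack `s` (head of the list = top of the stack) has no subsequence equivalent to `σ`. -/
def Avoids (σ s : List A) : Prop :=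
  ∀ t : List A, t.Sublist s → ¬ Equivalent t σ

open Classical in
/-- `run σ input stack` is the word output by the machine from the given remaining input and
stack (head = top) onwards. The next letter is pushed if the stack then still avoids `σ` (or if the
stack is empty); otherwise the top of the stack is popped to the end of the output. Once the input
is exhausted, the stack is popped from top to bottom. -/
noncomputable def run (σ : List A) : List A → List A → List A
  | [], s => s
  | x :: xs, [] => run σ xs [x]
  | x :: xs, y :: s =>
      if Avoids σ (x :: y :: s) then run σ xs (x :: y :: s)
      else y :: run σ (x :: xs) s
termination_by input s => 2 * input.length + s.length

/-- The stack-sorting map `φ_σ`. -/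
noncomputable def phi (σ p : List A) : List A :=
  run σ p []

end StackSort

/-! Pushing a letter onto an `aba`-avoiding stack is forbidden exactly when that letter occurs below
a different top letter. The machine is therefore `sweep`: a letter already on the stack ejects
everything above it.

Call a letter clumped if its occurrences are consecutive. Clumped letters stay clumped, and deleting
them commutes with a pass (`sweep_filter`). The first unclumped letter lies under everything that
can disturb it and becomes clumped (`clump_sweep_first`). Hence each pass gains at least one letter,
and `N` passes sort a word with `N` letters. A word that is still unsorted after `N - 1` passes
never gains a second letter in a pass; this is the condition `Tight`, stated after deleting the
letters already gained.

A tight word with at least two letters has no clumped letter, so each letter occurs at least twice.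
With length `2N + 1`, one letter occurs three times and all others twice. Tight words with every
letter occurring twice are squares `v v` (`Tight.eq_append_self`), because an output word without
adjacent equal letters comes from a repetition-free input, which is merely reversed. Undoing one
more pass from `v v`, or from `v v` with one letter doubled, leaves three families
(`Tight.classify`). The first letter `x` may be the threefold one, its three gaps cutting `v v` into
pieces; otherwise the doubled letter comes from the right or from the left gap of `x`.

Conversely, every member of a family is sent to `v v x` up to doublings. Doublings persist under
`sweep` and cannot make an unsorted word sorted. From `v v x`, each pass shortens the repeated block
by one letter, so it stays unsorted long enough. The families are indexed by pairs `j ≤ i` with `i <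
N`, and twice by pairs with `i < N - 1`; this gives the two binomial terms. -/

namespace StackSort

universe u

variable {A : Type u}

/-! ### Clumped letters -/

/-- All occurrences of `z` in `p` are consecutive. -/
def Clump (z : A) (p : List A) : Prop :=
  ∀ y, [z, y, z].Sublist p → y = z

theorem Clump.sublist {z : A} {p q : List A} (h : Clump z p) (hq : q.Sublist p) : Clump z q :=
  fun y hy => h y (hy.trans hq)

theorem clump_of_notMem {z : A} {p : List A} (h : z ∉ p) : Clump z p :=
  fun _ hy => absurd (hy.subset (by simp)) h

theorem triple_sublist_append_cons {z y : A} {l r : List A} (hl : z ∈ l) (hr : z ∈ r) :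
    [z, y, z].Sublist (l ++ y :: r) :=
  (List.singleton_sublist.2 hl).append ((List.singleton_sublist.2 hr).cons_cons y)

theorem exists_of_triple_sublist {x y z : A} {p : List A} (h : [x, y, z].Sublist p) :
    ∃ l₁ l₂ l₃ l₄, p = l₁ ++ x :: (l₂ ++ y :: (l₃ ++ z :: l₄)) := by
  rw [List.cons_sublist_iff] at h
  obtain ⟨r₁, r₂, rfl, h₁, h⟩ := h
  rw [List.cons_sublist_iff] at h
  obtain ⟨r₃, r₄, rfl, h₂, h⟩ := h
  rw [List.singleton_sublist] at h
  obtain ⟨a, b, rfl⟩ := List.append_of_mem h₁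
  obtain ⟨c, d, rfl⟩ := List.append_of_mem h₂
  obtain ⟨e, f, rfl⟩ := List.append_of_mem h
  exact ⟨a, b ++ c, d ++ e, f, by simp⟩

theorem Clump.append {z : A} {l r : List A} (hl : z ∉ l) (hr : Clump z r) : Clump z (l ++ r) := by
  intro y hy
  apply hr
  rw [List.sublist_append_iff] at hy
  obtain ⟨l₁, l₂, h, h₁, h₂⟩ := hy
  rcases l₁ with _ | ⟨w, l₁⟩
  · simp at h; rwa [h]
  · simp at h; exact absurd (h₁.subset (by simp [h.1])) hl

theorem Clump.append_right {z : A} {l r : List A} (hl : Clump z l) (hr : z ∉ r) :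
    Clump z (l ++ r) := by
  intro y hy
  have h' : [z, y, z].Sublist (l ++ r).reverse := by simpa using hy.reverse
  have : Clump z (r.reverse ++ l.reverse) := by
    refine Clump.append (by simpa using hr) ?_
    intro y hy
    exact hl y (by simpa using hy.reverse)
  exact this y (by simpa using h')

theorem Clump.cons {z x : A} {r : List A} (hx : z ≠ x) (hr : Clump z r) : Clump z (x :: r) :=
  Clump.append (l := [x]) (by simpa using hx) hr

theorem isSorted_iff {p : List A} : IsSorted p ↔ ∀ z, Clump z p := by
  constructor
  · intro h z y hy
    obtain ⟨l₁, l₂, l₃, l₄, rfl⟩ := exists_of_triple_sublist hy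
    have := h l₁.length (l₁.length + 1 + l₂.length) (l₁.length + 1 + l₂.length + 1 + l₃.length)
      (by omega) (by omega) (by simp; omega)
    simpa [List.getElem_append, List.getElem_cons, Nat.add_assoc, show ∀ a b : ℕ, a + b - a = b by omega,
      show ∀ a b c : ℕ, (a + (b + c)) - a = b + c by omega] using this
  · intro h i j k hij hjk hk hik
    apply h
    rw [List.sublist_iff_exists_fin_orderEmbedding_get_eq]
    refine ⟨OrderEmbedding.ofStrictMono ![⟨i, by omega⟩, ⟨j, by omega⟩, ⟨k, hk⟩] ?_, ?_⟩
    · rw [Fin.strictMono_iff_lt_succ]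
      intro t
      fin_cases t <;> simpa
    · intro t
      fin_cases t <;> simp [hik]

/-! ### The `aba` machine as the recursion `sweep` -/

section Sweep

variable [DecidableEq A]

/-- The `aba`-avoiding stack machine: a letter already on the stack ejects everything above it. -/
def sweep : List A → List A → List A
  | [], s => s
  | x :: w, s =>
      if x ∈ s then s.takeWhile (· ≠ x) ++ sweep w (x :: s.dropWhile (· ≠ x))
      else sweep w (x :: s)

@[simp] theorem sweep_nil (s : List A) : sweep [] s = s := rfl

theorem sweep_cons_notMem {x : A} {s : List A} (w : List A) (h : x ∉ s) :
    sweep (x :: w) s = sweep w (x :: s) := by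
  simp [sweep, h]

theorem sweep_cons_split {x : A} {t : List A} (w s : List A) (h : x ∉ t) :
    sweep (x :: w) (t ++ x :: s) = t ++ sweep w (x :: x :: s) := by
  have h' : ∀ y ∈ t, y ≠ x := fun y hy e => h (e ▸ hy)
  have h1 : (t ++ x :: s).takeWhile (· ≠ x) = t := by
    rw [List.takeWhile_append_of_pos (by simpa using h')]; simp
  have h2 : (t ++ x :: s).dropWhile (· ≠ x) = x :: s := by
    rw [List.dropWhile_append_of_pos (by simpa using h')]; simp
  rw [sweep, if_pos (by simp), h1, h2]

theorem notMem_or_split (x : A) (s : List A) : x ∉ s ∨ ∃ t s', s = t ++ x :: s' ∧ x ∉ t := by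
  by_cases h : x ∈ s
  · exact Or.inr (List.eq_append_cons_of_mem h)
  · exact Or.inl h

theorem sweep_perm (w : List A) : ∀ s, (sweep w s).Perm (w ++ s) := by
  induction w with
  | nil => simp
  | cons x w ih =>
    intro s
    rcases notMem_or_split x s with h | ⟨t, s, rfl, h⟩
    · rw [sweep_cons_notMem _ h]
      exact (ih _).trans (by simp)
    · rw [sweep_cons_split _ _ h]
      refine ((ih _).append_left t).trans ?_
      rw [List.perm_iff_count]
      intro a
      simp [List.count_cons]
      ring

end Sweep

/-- The full permutation group is multiply transitive, on infinite alphabets too. -/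
theorem exists_perm_map_eq {l l' : List A} (h : l.Nodup) (h' : l'.Nodup)
    (hlen : l.length = l'.length) : ∃ f : Equiv.Perm A, l.map f = l' := by
  obtain ⟨f, hf⟩ := (Equiv.Perm.isMultiplyPretransitive A l.length).exists_smul_eq
    ⟨l.get, List.nodup_iff_injective_get.1 h⟩
    ⟨fun i => l'.get (i.cast hlen),
      (List.nodup_iff_injective_get.1 h').comp (Fin.cast_injective hlen)⟩
  refine ⟨f, List.ext_get (by simpa using hlen) fun n h₁ h₂ => ?_⟩
  simpa using DFunLike.congr_fun hf ⟨n, by simpa using h₁⟩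

theorem avoids_aba_iff {a b : A} (hab : a ≠ b) {s : List A} :
    Avoids [a, b, a] s ↔ ∀ z, Clump z s := by
  classical
  constructor
  · intro h z y hy
    by_contra hne
    refine h _ hy ?_
    obtain ⟨f, hf⟩ := exists_perm_map_eq (l := [z, y]) (l' := [a, b])
      (by simpa using Ne.symm hne) (by simpa using hab) rfl
    simp at hf
    exact ⟨f, by simp [hf]⟩
  · rintro h t ht ⟨f, hf⟩
    have hlen : t.length = 3 := by simpa using (congrArg List.length hf).symm
    obtain ⟨x, y, z, rfl⟩ := List.length_eq_three.1 hlen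
    simp at hf
    obtain ⟨h1, h2, h3⟩ := hf
    have hxz : x = z := f.injective (h1.symm.trans h3)
    subst hxz
    have := h x y ht
    subst this
    exact hab (h1.trans h2.symm)

/-- On a clumped stack, pushing `x` is illegal exactly while some `x` lies below a different top
letter. So the machine pops until `x` is on top, and the stack remains clumped after the push. -/
theorem run_eq_sweep [DecidableEq A] {a b : A} (hab : a ≠ b) (w : List A) :
    ∀ s, (∀ z, Clump z s) → run [a, b, a] w s = sweep w s := by
  induction w with
  | nil => intro s _; simp [run]
  | cons x w ih =>
    intro s hs
    have key : ∀ s, (∀ z, Clump z s) → (∀ z, Clump z (x :: s)) →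
        run [a, b, a] (x :: w) s = sweep w (x :: s) := by
      intro s hs hx
      cases s with
      | nil => rw [run]; exact ih _ hx
      | cons y s => rw [run, if_pos ((avoids_aba_iff hab).2 hx)]; exact ih _ hx
    rcases notMem_or_split x s with h | ⟨t, s, rfl, h⟩
    · rw [sweep_cons_notMem _ h]
      refine key s hs fun z => ?_
      by_cases hz : z = x
      · subst hz
        exact Clump.append_right (l := [z]) (fun y hy => by simpa using hy.length_le) h
      · exact (hs z).cons hz
    · rw [sweep_cons_split _ _ h]
      induction t with
      | nil =>
        refine key _ hs fun z => ?_
        by_cases hz : z = x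
        · subst hz
          intro y hy
          by_contra hne
          rw [List.cons_sublist_cons, List.nil_append, List.sublist_cons_iff] at hy
          rcases hy with hy | ⟨r, hr, -⟩
          · exact hne (hs z y (hy.cons_cons z))
          · simp at hr; exact hne hr.1
        · exact (hs z).cons hz
      | cons y t iht =>
        rw [List.cons_append, run, if_neg, iht, List.cons_append]
        · simp at h; exact h.2
        · exact fun z => (hs z).sublist (by simp)
        · rw [avoids_aba_iff hab]
          intro hc
          simp at h
          refine h.1 (hc x y ?_).symm
          simp

theorem phi_eq_sweep [DecidableEq A] {a b : A} (hab : a ≠ b) (p : List A) :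
    phi [a, b, a] p = sweep p [] :=
  run_eq_sweep hab p [] fun _ => clump_of_notMem (by simp)

theorem clump_append_replicate {x : A} {l : List A} (hl : x ∉ l) (k : ℕ) :
    Clump x (l ++ List.replicate k x) :=
  Clump.append hl fun y hy => List.eq_of_mem_replicate (hy.subset (by simp))

/-! ### Computing passes, and the letters that a pass clumps -/

section Sweep

variable [DecidableEq A]

theorem sweep_append_disjoint (w : List A) :
    ∀ s t, (∀ z ∈ w, z ∉ t) → sweep w (s ++ t) = sweep w s ++ t := by
  induction w with
  | nil => simp
  | cons x w ih =>
    intro s t hw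
    have hx : x ∉ t := hw x (by simp)
    have hw' : ∀ z ∈ w, z ∉ t := fun z hz => hw z (by simp [hz])
    rcases notMem_or_split x s with h | ⟨s₁, s₂, rfl, h⟩
    · rw [sweep_cons_notMem _ h, sweep_cons_notMem _ (by simp [h, hx]), ← List.cons_append,
        ih _ _ hw']
    · rw [List.append_assoc, List.cons_append, sweep_cons_split _ _ h, sweep_cons_split _ _ h,
        List.append_assoc, ← ih _ _ hw']
      simp

/-- The next `x` ejects all that has accumulated above the previous one, so the gap between them is
processed as if nothing lay below it. -/
theorem sweep_append_cons {x : A} (v t : List A) (w : List A) :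
    ∀ s, x ∉ w → x ∉ s → (∀ z ∈ w, z ∉ t) →
      sweep (w ++ x :: v) (s ++ x :: t) = sweep w s ++ sweep v (x :: x :: t) := by
  induction w with
  | nil =>
    intro s _ hs _
    simpa using sweep_cons_split v t hs
  | cons y w ih =>
    intro s hw hs ht
    simp only [List.mem_cons, not_or] at hw
    have hy : y ∉ t := ht y (by simp)
    have ht' : ∀ z ∈ w, z ∉ t := fun z hz => ht z (by simp [hz])
    rcases notMem_or_split y s with h | ⟨s₁, s₂, rfl, h⟩
    · rw [sweep_cons_notMem _ h, List.cons_append,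
        sweep_cons_notMem _ (by simp [h, hy, Ne.symm hw.1]), ← List.cons_append,
        ih _ hw.2 (by simp [hs, hw.1]) ht']
    · rw [sweep_cons_split _ _ h, List.cons_append, List.append_assoc, List.cons_append,
        sweep_cons_split _ _ h, List.append_assoc, ← ih _ hw.2 _ ht']
      · simp
      · simp at hs; simp [hs]

theorem sweep_append_of_nodup (v w : List A) :
    ∀ s, w.Nodup → (∀ z ∈ w, z ∉ s) → sweep (w ++ v) s = sweep v (w.reverse ++ s) := by
  induction w with
  | nil => simp
  | cons x w ih =>
    intro s hw hs
    rw [List.nodup_cons] at hw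
    rw [List.cons_append, sweep_cons_notMem _ (hs x (by simp)), ih _ hw.2]
    · simp
    · intro z hz
      simp only [List.mem_cons, not_or]
      exact ⟨fun e => hw.1 (e ▸ hz), hs z (by simp [hz])⟩

theorem sweep_of_nodup {w : List A} (hw : w.Nodup) : sweep w [] = w.reverse := by
  simpa using sweep_append_of_nodup [] w [] hw (by simp)

theorem sweep_two {x : A} {w₁ w₂ : List A} (h₁ : x ∉ w₁) (h₂ : x ∉ w₂) :
    sweep (x :: (w₁ ++ x :: w₂)) [] = sweep w₁ [] ++ (sweep w₂ [] ++ [x, x]) := by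
  rw [sweep_cons_notMem _ (by simp)]
  have := sweep_append_cons (x := x) w₂ [] w₁ [] h₁ (by simp) (by simp)
  rw [List.nil_append] at this
  rw [this]
  congr 1
  exact sweep_append_disjoint w₂ [] [x, x] (by
    intro z hz; simp; rintro rfl; exact h₂ hz)

theorem sweep_three {x : A} {w₁ w₂ w₃ : List A} (h₁ : x ∉ w₁) (h₂ : x ∉ w₂) (h₃ : x ∉ w₃) :
    sweep (x :: (w₁ ++ x :: (w₂ ++ x :: w₃))) [] =
      sweep w₁ [] ++ (sweep w₂ [] ++ (sweep w₃ [] ++ [x, x, x])) := by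
  rw [sweep_cons_notMem _ (by simp)]
  have := sweep_append_cons (x := x) (w₂ ++ x :: w₃) [] w₁ [] h₁ (by simp) (by simp)
  rw [List.nil_append] at this
  rw [this]
  have := sweep_append_cons (x := x) w₃ [x] w₂ [] h₂ (by simp) (by
    intro z hz; simp; rintro rfl; exact h₂ hz)
  rw [List.nil_append] at this
  rw [this]
  congr 2
  exact sweep_append_disjoint w₃ [] [x, x, x] (by
    intro z hz; simp; rintro rfl; exact h₃ hz)

theorem exists_sweep_bottom (x : A) (w : List A) :
    ∀ s k, x ∉ s → ∃ l j, x ∉ l ∧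
      sweep w (s ++ List.replicate (k + 1) x) = l ++ List.replicate (j + 1) x := by
  induction w with
  | nil => intro s k hs; exact ⟨s, k, hs, rfl⟩
  | cons y w ih =>
    intro s k hs
    by_cases hyx : y = x
    · subst hyx
      obtain ⟨l, j, hl, h⟩ := ih [] (k + 1) (by simp)
      refine ⟨s ++ l, j, by simp [hs, hl], ?_⟩
      rw [List.append_assoc, ← h, List.replicate_succ, sweep_cons_split _ _ hs]
      simp [List.replicate_succ]
    rcases notMem_or_split y s with h | ⟨s₁, s₂, rfl, h⟩
    · obtain ⟨l, j, hl, e⟩ := ih (y :: s) k (by simp [hs, Ne.symm hyx])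
      refine ⟨l, j, hl, ?_⟩
      rw [sweep_cons_notMem _ (by simp [h, hyx]), ← e, List.cons_append]
    · simp at hs
      obtain ⟨l, j, hl, e⟩ := ih (y :: y :: s₂) k (by simp [hs])
      refine ⟨s₁ ++ l, j, by simp [hs, hl], ?_⟩
      rw [List.append_assoc, List.cons_append, sweep_cons_split _ _ h, List.append_assoc, ← e]
      simp

theorem sweep_cons_eq (x : A) (w : List A) :
    ∃ l j, x ∉ l ∧ sweep (x :: w) [] = l ++ List.replicate (j + 1) x := by
  rw [sweep_cons_notMem _ (by simp)]
  simpa using exists_sweep_bottom x w [] 0 (by simp)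

/-- The last letter of an output word is the first letter of the input, and it is clumped. -/
theorem clump_last_sweep {w l : List A} {z : A} (h : sweep w [] = l ++ [z]) :
    Clump z (sweep w []) := by
  cases w with
  | nil => simp at h
  | cons x w =>
    obtain ⟨l', j, hl, e⟩ := sweep_cons_eq x w
    have : z = x := by
      have := congrArg List.getLast? (h.symm.trans e)
      simpa [List.getLast?_append, List.getLast?_replicate] using this
    rw [e, this]
    exact clump_append_replicate hl _

/-- The letters `y` can only be separated if some `x` below them ejects them and another `y` arrives
afterwards, which needs the pattern `x y x y`. Without it, an ejection of `y` by `x` takes every `y`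
at once: a `y` below `x` would already violate clumping of the stack. -/
theorem clump_sweep {y : A} (w : List A) : ∀ s,
    (∀ x, x ≠ y → ¬ [x, y, x, y].Sublist (s.reverse ++ w)) → Clump y s →
      Clump y (sweep w s) := by
  induction w with
  | nil => intro s _ h; exact h
  | cons x w ih =>
    intro s hp hs
    rcases notMem_or_split x s with h | ⟨s₁, s₂, rfl, h⟩
    · rw [sweep_cons_notMem _ h]
      refine ih _ (by simpa using hp) ?_
      by_cases hxy : y = x
      · subst hxy
        exact Clump.append_right (l := [y]) (fun _ hy => by simpa using hy.length_le) h
      · exact hs.cons hxy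
    · rw [sweep_cons_split _ _ h]
      have hp' : ∀ z, z ≠ y → ¬ [z, y, z, y].Sublist ((x :: x :: s₂).reverse ++ w) := by
        intro z hz hsub
        refine hp z hz (hsub.trans ?_)
        simp
      have hs' : Clump y (x :: x :: s₂) := by
        by_cases hxy : y = x
        · subst hxy
          intro z hz
          by_contra hne
          rw [List.cons_sublist_cons, List.sublist_cons_iff] at hz
          rcases hz with hz | ⟨r, hr, -⟩
          · exact hne (hs z ((hz.cons_cons y).trans (by simp)))
          · simp at hr; exact hne hr.1
        · exact ((hs.sublist (List.sublist_append_right _ _)).cons hxy)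
      by_cases hy : y ∈ s₁
      · have hxy : x ≠ y := fun e => h (e ▸ hy)
        have h₂ : y ∉ s₂ := fun hy₂ => hxy (hs x (triple_sublist_append_cons hy hy₂))
        have hw : y ∉ w := by
          intro hw
          refine hp x hxy ?_
          have h1 : [x, y].Sublist (s₁ ++ x :: s₂).reverse := by
            simpa using ((List.singleton_sublist.2 hy).append
              (List.singleton_sublist.2 (List.mem_cons_self (a := x) (l := s₂)))).reverse
          exact h1.append ((List.singleton_sublist.2 hw).cons_cons x)
        refine Clump.append_right (hs.sublist (List.sublist_append_left _ _)) ?_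
        rw [(sweep_perm w _).mem_iff]
        simp [hw, h₂, Ne.symm hxy]
      · exact Clump.append hy (ih _ hp' hs')

theorem Clump.sweep {y : A} {p : List A} (h : Clump y p) : Clump y (StackSort.sweep p []) := by
  refine clump_sweep p [] (fun x hx hsub => hx (h x ?_)) (clump_of_notMem (by simp))
  exact (List.sublist_cons_self x _).trans hsub

theorem Clump.notMem_or_top {c : A} {s w : List A} (h : Clump c (s.reverse ++ c :: w)) :
    c ∉ s ∨ ∃ s', s = c :: s' := by
  rcases s with _ | ⟨d, s⟩
  · simp
  · by_cases hd : d = c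
    · exact Or.inr ⟨s, by rw [hd]⟩
    · left
      simp only [List.mem_cons, not_or]
      refine ⟨Ne.symm hd, fun hc => hd (h d ?_)⟩
      have := triple_sublist_append_cons (y := d) (List.mem_reverse.2 hc)
        (List.mem_cons_self (a := c) (l := w))
      simpa using this

/-- A clumped letter finds itself absent from the stack or on top of it, so it never ejects anything
and the other letters do not notice it. -/
theorem sweep_filter (C : A → Bool) (w : List A) : ∀ s,
    (∀ c, C c = false → Clump c (s.reverse ++ w)) →
      (sweep w s).filter C = sweep (w.filter C) (s.filter C) := by
  induction w with
  | nil => simp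
  | cons x w ih =>
    intro s hs
    by_cases hx : C x = true
    · rw [List.filter_cons_of_pos hx]
      rcases notMem_or_split x s with h | ⟨s₁, s₂, rfl, h⟩
      · rw [sweep_cons_notMem _ h, sweep_cons_notMem _ (by simp [h]),
          ih _ (by simpa using hs), List.filter_cons_of_pos hx]
      · rw [sweep_cons_split _ _ h, List.filter_append, List.filter_append,
          List.filter_cons_of_pos hx, sweep_cons_split _ _ (by simp [h]), ih]
        · simp [hx]
        · intro c hc
          exact (hs c hc).sublist (by simp)
    · rw [List.filter_cons_of_neg hx]
      have := (hs x (by simpa using hx)).notMem_or_top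
      rcases this with h | ⟨s, rfl⟩
      · rw [sweep_cons_notMem _ h, ih _ (by simpa using hs), List.filter_cons_of_neg hx]
      · have := sweep_cons_split (x := x) (t := []) w s (by simp)
        rw [List.nil_append, List.nil_append] at this
        rw [this, ih _ (by simpa using hs), List.filter_cons_of_neg hx]

theorem sweep_append_of_clump (v w : List A) :
    ∀ s, (∀ c ∈ w, Clump c (s.reverse ++ w ++ v)) → sweep (w ++ v) s = sweep v (w.reverse ++ s) := by
  induction w with
  | nil => simp
  | cons x w ih =>
    intro s hs
    have key : sweep (x :: (w ++ v)) s = sweep (w ++ v) (x :: s) := by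
      have h := hs x (by simp)
      simp only [List.append_assoc, List.cons_append] at h
      rcases h.notMem_or_top with h | ⟨s, rfl⟩
      · exact sweep_cons_notMem _ h
      · simpa using sweep_cons_split (x := x) (t := []) (w ++ v) s (by simp)
    rw [List.cons_append, key, ih]
    · simp
    · intro c hc
      simpa using hs c (by simp [hc])

/-- The first letter outside a set of clumped letters becomes clumped. -/
theorem clump_sweep_first {B w : List A} {x : A} (hx : x ∉ B)
    (hB : ∀ c ∈ B, Clump c (B ++ x :: w)) : Clump x (sweep (B ++ x :: w) []) := by
  -- A letter of `B` recurring after `x` would not be clumped. So the reversal of `B` rests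
  -- undisturbed at the bottom, and `x` behaves like the first letter of an input.
  have hBw : ∀ z ∈ x :: w, z ∉ B.reverse := by
    intro z hz hzB
    rw [List.mem_reverse] at hzB
    simp only [List.mem_cons] at hz
    rcases hz with rfl | hz
    · exact hx hzB
    · exact hx (hB z hzB x (triple_sublist_append_cons hzB hz) ▸ hzB)
  rw [sweep_append_of_clump _ _ _ (by simpa using hB), List.append_nil]
  have := sweep_append_disjoint (x :: w) [] B.reverse hBw
  rw [List.nil_append] at this
  rw [this]
  refine Clump.append_right ?_ (by simpa using hx)
  obtain ⟨l, j, hl, e⟩ := sweep_cons_eq x w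
  rw [e]
  exact clump_append_replicate hl _

end Sweep

/-! ### Doubling a letter -/

/-- `p` arises from `q` by doubling one letter in place. -/
def Dup (p q : List A) : Prop :=
  ∃ l b r, p = l ++ b :: b :: r ∧ q = l ++ b :: r

theorem Dup.append_left {p q : List A} (h : Dup p q) (l : List A) : Dup (l ++ p) (l ++ q) := by
  obtain ⟨l', b, r, rfl, rfl⟩ := h
  exact ⟨l ++ l', b, r, by simp, by simp⟩

theorem Dup.append_right {p q : List A} (h : Dup p q) (r : List A) : Dup (p ++ r) (q ++ r) := by
  obtain ⟨l, b, r', rfl, rfl⟩ := h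
  exact ⟨l, b, r' ++ r, by simp, by simp⟩

theorem Dup.sublist {p q : List A} (h : Dup p q) : q.Sublist p := by
  obtain ⟨l, b, r, rfl, rfl⟩ := h
  simp

theorem Dup.clump {p q : List A} (h : Dup p q) {z : A} (hq : Clump z q) : Clump z p := by
  obtain ⟨l, b, r, rfl, rfl⟩ := h
  intro y hy
  by_contra hne
  refine hne (hq y ?_)
  have e : l ++ b :: b :: r = (l ++ [b]) ++ (b :: r) := by simp
  rw [e, List.sublist_append_iff] at hy
  obtain ⟨l₁, l₂, h, h₁, h₂⟩ := hy
  rw [h]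
  rw [List.sublist_append_iff] at h₁
  obtain ⟨l₃, l₄, rfl, h₃, h₄⟩ := h₁
  rw [List.append_assoc]
  refine h₃.append ?_
  rw [List.sublist_singleton] at h₄
  rcases h₄ with rfl | rfl
  · simpa using h₂
  · rw [List.sublist_cons_iff] at h₂
    rcases h₂ with h₂ | ⟨r', rfl, -⟩
    · simpa using h₂
    -- Here `z y z` uses both copies of `b`, so two of its neighbouring letters agree and `y = z`.
    · rcases l₃ with _ | ⟨c, _ | ⟨d, l₃⟩⟩ <;> simp at h
      · exact absurd (h.2.1.trans h.1.symm) hne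
      · exact absurd (h.2.1.trans h.2.2.1.symm) hne
      · have := congrArg List.length h.2.2
        simp at this
        omega

section

variable [DecidableEq A]

theorem Dup.sweep_stack (w : List A) : ∀ {s t : List A}, Dup s t → Dup (sweep w s) (sweep w t) := by
  induction w with
  | nil => intro s t h; exact h
  | cons x w ih =>
    intro s t h
    obtain ⟨l, b, r, rfl, rfl⟩ := h
    rcases notMem_or_split x l with h | ⟨l₁, l₂, rfl, h⟩
    · by_cases hxb : x = b
      · subst hxb
        rw [sweep_cons_split _ _ h, sweep_cons_split _ _ h]
        exact (ih ⟨[x], x, r, rfl, rfl⟩).append_left l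
      rcases notMem_or_split x r with h' | ⟨r₁, r₂, rfl, h'⟩
      · rw [sweep_cons_notMem _ (by simp [*]), sweep_cons_notMem _ (by simp [*])]
        exact ih ⟨x :: l, b, r, rfl, rfl⟩
      · have h1 := sweep_cons_split (x := x) (t := l ++ b :: b :: r₁) w r₂ (by simp [*])
        have h2 := sweep_cons_split (x := x) (t := l ++ b :: r₁) w r₂ (by simp [*])
        simp only [List.append_assoc, List.cons_append] at h1 h2
        rw [h1, h2]
        exact ⟨l, b, _, rfl, rfl⟩
    · simp only [List.append_assoc, List.cons_append]
      rw [sweep_cons_split _ _ h, sweep_cons_split _ _ h]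
      exact (ih ⟨x :: x :: l₂, b, r, rfl, rfl⟩).append_left l₁

/-- The second copy of the letter lands directly on the first without ejecting anything, and
adjacent equal letters on the stack are never separated. -/
theorem Dup.sweep {p q : List A} (h : Dup p q) : Dup (StackSort.sweep p []) (StackSort.sweep q []) := by
  obtain ⟨l, b, r, rfl, rfl⟩ := h
  have : ∀ s, Dup (StackSort.sweep (l ++ b :: b :: r) s) (StackSort.sweep (l ++ b :: r) s) := by
    induction l with
    | nil =>
      intro s
      simp only [List.nil_append]
      have hb : ∀ t, StackSort.sweep (b :: r) (b :: t) = StackSort.sweep r (b :: b :: t) := fun t => by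
        simpa using sweep_cons_split (x := b) (t := []) r t (by simp)
      rcases notMem_or_split b s with h | ⟨s₁, s₂, rfl, h⟩
      · rw [sweep_cons_notMem _ h, sweep_cons_notMem _ h, hb]
        exact Dup.sweep_stack _ ⟨[], b, s, rfl, rfl⟩
      · rw [sweep_cons_split _ _ h, sweep_cons_split _ _ h, hb]
        exact (Dup.sweep_stack _ ⟨[], b, b :: s₂, rfl, rfl⟩).append_left _
    | cons x l ih =>
      intro s
      rcases notMem_or_split x s with h | ⟨s₁, s₂, rfl, h⟩
      · rw [List.cons_append, List.cons_append, sweep_cons_notMem _ h, sweep_cons_notMem _ h]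
        exact ih _
      · rw [List.cons_append, List.cons_append, sweep_cons_split _ _ h, sweep_cons_split _ _ h]
        exact (ih _).append_left _
  exact this []

theorem Dup.iterate {p q : List A} (h : Dup p q) (k : ℕ) :
    Dup ((fun p => StackSort.sweep p [])^[k] p) ((fun p => StackSort.sweep p [])^[k] q) := by
  induction k generalizing p q with
  | zero => exact h
  | succ k ih => exact ih h.sweep

/-- An output word is repetition-free or has two equal adjacent letters. -/
theorem nodup_or_dup_sweep (w : List A) :
    w.Nodup ∨ ∃ q, Dup (sweep w []) q := by
  have : ∀ s : List A, s.Nodup → (w.reverse ++ s).Nodup ∨ ∃ q, Dup (sweep w s) q := by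
    induction w with
    | nil => intro s hs; exact Or.inl (by simpa using hs)
    | cons x w ih =>
      intro s hs
      rcases notMem_or_split x s with h | ⟨s₁, s₂, rfl, h⟩
      · rw [sweep_cons_notMem _ h]
        simpa using ih (x :: s) (List.nodup_cons.2 ⟨h, hs⟩)
      -- The first repeated letter is pushed directly onto its earlier occurrence, and this doubling
      -- survives to the output.
      · right
        rw [sweep_cons_split _ _ h]
        exact ⟨_, (Dup.sweep_stack w ⟨[], x, s₂, rfl, rfl⟩).append_left s₁⟩
  simpa using this [] (by simp)

end

theorem Dup.filter {p q : List A} (h : Dup p q) (C : A → Bool) :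
    p.filter C = q.filter C ∨ Dup (p.filter C) (q.filter C) := by
  obtain ⟨l, b, r, rfl, rfl⟩ := h
  by_cases hb : C b
  · exact Or.inr ⟨l.filter C, b, r.filter C, by simp [hb], by simp [hb]⟩
  · exact Or.inl (by simp [hb])

theorem Dup.head? {p q : List A} (h : Dup p q) : p.head? = q.head? := by
  obtain ⟨l, b, r, rfl, rfl⟩ := h
  cases l <;> simp

/-! ### Tight words: exactly one letter gained per pass -/

/-- No letter but possibly the first one is clumped. -/
def HeadOnly (q : List A) : Prop :=
  ∀ z ∈ q, Clump z q → q.head? = some z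

theorem Dup.headOnly {p q : List A} (h : Dup p q) (hp : HeadOnly p) : HeadOnly q := by
  intro z hz hc
  rw [← h.head?]
  exact hp z (h.sublist.subset hz) (h.clump hc)

section

variable [DecidableEq A]

theorem clump_sweep_filter_head {D : Finset A} {p : List A} (hp : ∀ z, z ∉ D → Clump z p) {x : A}
    (hx : (p.filter (· ∈ D)).head? = some x) : Clump x (sweep p []) := by
  obtain ⟨q, hq⟩ := List.head?_eq_some_iff.1 hx
  rw [List.filter_eq_cons_iff] at hq
  obtain ⟨B, w, rfl, hB, hxD, -⟩ := hq
  refine clump_sweep_first (fun h => hB x h hxD) fun c hc => hp c ?_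
  simpa using hB c hc

/-- `D` contains every letter that may be unclumped, and each pass removes at least one letter from
it, namely the first letter of `D` in the word. -/
theorem isSorted_iterate_sweep (n : ℕ) : ∀ (D : Finset A) (p : List A), D.card = n →
    (∀ z, z ∉ D → Clump z p) → IsSorted ((fun p => sweep p [])^[n] p) := by
  induction n with
  | zero =>
    intro D p hD hp
    rw [Finset.card_eq_zero] at hD
    subst hD
    exact isSorted_iff.2 fun z => hp z (by simp)
  | succ n ih =>
    intro D p hD hp
    obtain ⟨x, hxD, hx⟩ : ∃ x ∈ D, Clump x (sweep p []) := by
      rcases hq : p.filter (· ∈ D) with _ | ⟨x, q⟩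
      · obtain ⟨x, hx⟩ : D.Nonempty := Finset.card_pos.1 (by omega)
        refine ⟨x, hx, (clump_of_notMem fun hxp => ?_).sweep⟩
        have : x ∈ p.filter (· ∈ D) := by simp [hx, hxp]
        simp [hq] at this
      · have hxq : x ∈ p.filter (· ∈ D) := by simp [hq]
        refine ⟨x, by simpa using (List.mem_filter.1 hxq).2, ?_⟩
        exact clump_sweep_filter_head hp (by simp [hq])
    refine ih (D.erase x) (sweep p []) (by simp [Finset.card_erase_of_mem hxD, hD]) fun z hz => ?_
    by_cases hzx : z = x
    · exact hzx ▸ hx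
    · exact (hp z (by simpa [hzx] using hz)).sweep

/-- One pass of the machine, after which the former first letter is deleted. -/
def peel (q : List A) : List A :=
  (sweep q []).filter (fun z => some z ≠ q.head?)

/-- During the repeated peeling of `q` only first letters are ever clumped. -/
def Tight (q : List A) : Prop :=
  ∀ i, HeadOnly (peel^[i] q)

theorem Tight.headOnly {q : List A} (h : Tight q) : HeadOnly q := h 0

theorem Tight.peel {q : List A} (h : Tight q) : Tight (peel q) := fun i => h (i + 1)

theorem tight_of {q : List A} (h : HeadOnly q) (h' : Tight (StackSort.peel q)) : Tight q := by
  intro i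
  cases i with
  | zero => exact h
  | succ i => exact h' i

theorem tight_nil : Tight ([] : List A) := by
  intro i
  have : (StackSort.peel^[i] ([] : List A)) = [] := by
    induction i with
    | zero => rfl
    | succ i ih => simpa [StackSort.peel] using ih
  simp [this, HeadOnly]

/-- With `n + 1` possibly unclumped letters, `n` passes fail only if no pass gains two of them. -/
theorem tight_of_not_isSorted (n : ℕ) : ∀ (D : Finset A) (p : List A), D.card = n + 1 →
    (∀ z, z ∉ D → Clump z p) → ¬ IsSorted ((fun p => sweep p [])^[n] p) →
      Tight (p.filter (· ∈ D)) := by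
  induction n with
  | zero =>
    intro D p hD _ _
    obtain ⟨x, rfl⟩ := Finset.card_eq_one.1 hD
    have h1 : ∀ z ∈ p.filter (· ∈ ({x} : Finset A)), z = x := by simp
    generalize p.filter (· ∈ ({x} : Finset A)) = q at h1
    rcases q with _ | ⟨y, q⟩
    · exact tight_nil
    · have hy := h1 y (by simp)
      subst hy
      refine tight_of (fun z hz _ => by simp [h1 z hz]) ?_
      have : peel (y :: q) = [] := by
        rw [peel, List.filter_eq_nil_iff]
        intro z hz
        have := h1 z (by simpa using (sweep_perm _ _).mem_iff.1 hz)
        simp [this]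
      rw [this]
      exact tight_nil
  | succ n ih =>
    intro D p hD hp hns
    rcases hq : p.filter (· ∈ D) with _ | ⟨x, q⟩
    · exact tight_nil
    rw [← hq]
    have hhead : (p.filter (· ∈ D)).head? = some x := by simp [hq]
    have hxD : x ∈ D := by
      have hxq : x ∈ p.filter (· ∈ D) := by simp [hq]
      simpa using (List.mem_filter.1 hxq).2
    have hx := clump_sweep_filter_head hp hhead
    have hp' : ∀ z, z ∉ D.erase x → Clump z (sweep p []) := by
      intro z hz
      by_cases hzx : z = x
      · exact hzx ▸ hx
      · exact (hp z (by simpa [hzx] using hz)).sweep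
    refine tight_of ?_ ?_
    -- A second clumped letter `z` of the filtered word would be clumped after this pass together
    -- with `x`. Only `n` letters of `D` would then remain, and the remaining `n` passes would sort
    -- the word.
    · intro z hz hc
      by_contra hne
      rw [hhead] at hne
      have hzx : z ≠ x := fun e => hne (by rw [e])
      have hzD : z ∈ D := by simpa using (List.mem_filter.1 hz).2
      have hcz : Clump z (sweep p []) := by
        refine clump_sweep p [] (fun y hy hsub => ?_) (clump_of_notMem (by simp))
        rw [List.reverse_nil, List.nil_append] at hsub
        by_cases hyD : y ∈ D
        · refine hy (hc y ?_)
          have := hsub.filter (· ∈ D)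
          simp only [List.filter_cons, hyD, hzD, decide_true, if_true, List.filter_nil] at this
          exact (List.sublist_cons_self y _).trans this
        · refine hy (hp y hyD z ?_).symm
          exact (List.Sublist.trans (by simp) hsub)
      have := isSorted_iterate_sweep n ((D.erase x).erase z) (sweep p [])
        (by rw [Finset.card_erase_of_mem (by simp [hzx, hzD]), Finset.card_erase_of_mem hxD]; omega)
        (by
          intro y hy
          by_cases hyz : y = z
          · exact hyz ▸ hcz
          · exact hp' y (by simpa [hyz] using hy))
      exact hns this
    · have : peel (p.filter (· ∈ D)) = (sweep p []).filter (· ∈ D.erase x) := by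
        have hf := sweep_filter (fun z => decide (z ∈ D)) p [] (by simpa using hp)
        rw [peel, hhead, List.filter_nil] at *
        rw [← hf, List.filter_filter]
        apply List.filter_congr
        intro z _
        simp
      rw [this]
      exact ih (D.erase x) (sweep p []) (by rw [Finset.card_erase_of_mem hxD]; omega) hp' hns

theorem mem_sweep {z : A} {p : List A} : z ∈ sweep p [] ↔ z ∈ p := by
  simpa using (sweep_perm p []).mem_iff (a := z)

theorem count_sweep (z : A) (p : List A) : (sweep p []).count z = p.count z := by
  simpa using (sweep_perm p []).count_eq z

/-- A tight word with two different letters has no clumped letter. -/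
theorem not_clump_of_tight {q : List A} (h : Tight q) {y z : A} (hy : y ∈ q) (hz : z ∈ q)
    (hyz : y ≠ z) : ¬ Clump z q := by
  intro hc
  have hhead := h.headOnly z hz hc
  have hpeel : peel q = sweep (q.filter (· ≠ z)) [] := by
    have := sweep_filter (fun y => decide (y ≠ z)) q [] (by simpa using hc)
    rw [List.filter_nil] at this
    rw [← this, peel, hhead]
    apply List.filter_congr
    intro z _
    simp
  have hye : y ∈ q.filter (· ≠ z) := by simp [hy, hyz]
  rcases he : q.filter (· ≠ z) with _ | ⟨c, e⟩
  · rw [he] at hye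
    simp at hye
  obtain ⟨l, j, hl, hs⟩ := sweep_cons_eq c e
  have hcl : Clump c (peel q) := by
    rw [hpeel, he, hs]; exact clump_append_replicate hl _
  have hhd := h.peel.headOnly c (by rw [hpeel, he, hs]; simp) hcl
  rw [hpeel, he, hs] at hhd
  -- The letter `c` ends the peeled word and, being clumped there, must also begin it. Hence `c` is
  -- the only letter left besides `z`, and it is then clumped in `q` without being its first letter.
  have hl0 : l = [] := by
    rcases l with _ | ⟨d, l⟩
    · rfl
    · simp at hhd hl
      exact absurd hhd.symm hl.1
  have hall : ∀ d ∈ q, d = z ∨ d = c := by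
    intro d hd
    by_cases hdz : d = z
    · exact Or.inl hdz
    · right
      have : d ∈ q.filter (· ≠ z) := by simp [hd, hdz]
      rw [he, ← mem_sweep, hs, hl0] at this
      simpa using this
  have hcm : c ∈ q.filter (· ≠ z) := by rw [he]; simp
  have hcq : c ∈ q ∧ c ≠ z := by simpa using hcm
  have hcc : Clump c q := by
    intro d hd
    rcases hall d (hd.subset (by simp)) with rfl | rfl
    · exfalso
      obtain ⟨w, rfl⟩ := List.head?_eq_some_iff.1 hhead
      rw [List.sublist_cons_iff] at hd
      rcases hd with hd | ⟨r, hr, -⟩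
      · refine hcq.2 (hc c ?_)
        refine List.Sublist.cons_cons d ?_
        refine List.Sublist.trans ?_ ((List.Sublist.cons_cons c ?_).trans hd) (l₂ := [c, d])
        · exact List.Sublist.refl _
        · simp
      · simp at hr
        exact hcq.2 hr.1
    · rfl
  have := h.headOnly c hcq.1 hcc
  rw [hhead] at this
  simp at this
  exact hcq.2 this.symm

theorem Dup.peel {p q : List A} (h : Dup p q) :
    peel p = peel q ∨ Dup (peel p) (peel q) := by
  rw [StackSort.peel, StackSort.peel, h.head?]
  exact h.sweep.filter _

/-- This reduces a word with one threefold letter to one in which all letters occur twice. The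
doubling survives each peeling until its letter is deleted, after which the two words coincide. -/
theorem Dup.tight {p q : List A} (h : Dup p q) (hp : Tight p) : Tight q := by
  intro i
  induction i generalizing p q with
  | zero => exact h.headOnly hp.headOnly
  | succ i ih =>
    rcases h.peel with e | h
    · have := hp (i + 1)
      rw [Function.iterate_succ_apply] at this ⊢
      rwa [← e]
    · exact ih h hp.peel

end

/-! ### Squares, and tight words with every letter occurring twice -/

theorem append_cons_inj_left {c : A} : ∀ {l l' r r' : List A}, c ∉ l → c ∉ l' →
    l ++ c :: r = l' ++ c :: r' → l = l' ∧ r = r'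
  | [], [], _, _, _, _, h => by simpa using h
  | [], d :: l', _, _, _, h', h => by simp at h h'; exact absurd h.1 h'.1
  | d :: l, [], _, _, h', _, h => by simp at h h'; exact absurd h.1.symm h'.1
  | d :: l, d' :: l', _, _, h₁, h₂, h => by
    simp only [List.cons_append, List.cons.injEq, List.mem_cons, not_or] at h h₁ h₂
    obtain ⟨rfl, h⟩ := h
    obtain ⟨rfl, rfl⟩ := append_cons_inj_left h₁.2 h₂.2 h
    exact ⟨rfl, rfl⟩

theorem Dup.not_nodup {p q : List A} (h : Dup p q) : ¬ p.Nodup := by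
  obtain ⟨l, b, r, rfl, rfl⟩ := h
  simp [List.nodup_append]

/-- Equal neighbours could only meet at the seam, where the last and first letters of `v` are
different. -/
theorem not_dup_append_self {v q : List A} (hv : v.Nodup) (h2 : 2 ≤ v.length) :
    ¬ Dup (v ++ v) q := by
  rintro ⟨l, b, r, h₀, -⟩
  rcases List.append_eq_append_iff.1 h₀ with ⟨a, rfl, h⟩ | ⟨a, h, h'⟩
  · exact Dup.not_nodup ⟨a, b, r, h, rfl⟩ hv
  · rcases a with _ | ⟨b', _ | ⟨b'', a⟩⟩
    · exact Dup.not_nodup ⟨[], b, r, by simpa using h'.symm, rfl⟩ hv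
    · simp at h'
      obtain ⟨rfl, rfl⟩ := h'
      rcases l with _ | ⟨c, l⟩
      · simp [h] at h2
      · simp at h
        simp [h.2] at hv
    · simp at h'
      obtain ⟨rfl, rfl, -⟩ := h'
      exact Dup.not_nodup ⟨l, b, a, h, rfl⟩ hv

theorem dup_append_self_cases {v q : List A} (h : Dup q (v ++ v)) :
    ∃ U, Dup U v ∧ (q = U ++ v ∨ q = v ++ U) := by
  obtain ⟨l, b, r, rfl, h₀⟩ := h
  rcases List.append_eq_append_iff.1 h₀ with ⟨a, rfl, h⟩ | ⟨a, h, h'⟩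
  · exact ⟨a ++ b :: b :: r, ⟨a, b, r, rfl, h⟩, Or.inr (by simp)⟩
  · rcases a with _ | ⟨b', a⟩
    · exact ⟨b :: b :: r, ⟨[], b, r, rfl, by simpa using h'.symm⟩, Or.inr (by simp [h])⟩
    · simp at h'
      obtain ⟨rfl, rfl⟩ := h'
      exact ⟨l ++ b :: b :: a, ⟨l, b, a, rfl, h⟩, Or.inl (by simp)⟩

theorem Dup.getLast? {p q : List A} (h : Dup p q) : p.getLast? = q.getLast? := by
  obtain ⟨l, b, r, rfl, rfl⟩ := h
  simp [List.getLast?_append, List.getLast?_cons]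

theorem Dup.mem_iff {p q : List A} (h : Dup p q) {z : A} : z ∈ p ↔ z ∈ q := by
  obtain ⟨l, b, r, rfl, rfl⟩ := h
  simp

section

variable [DecidableEq A]

theorem length_le_of_nodup_sweep {w v : List A} (hw : w.Nodup)
    (h : ∀ z ∈ sweep w [], z ∈ v) : (sweep w []).length ≤ v.length := by
  have hn : (sweep w []).Nodup := by rw [sweep_of_nodup hw]; simpa using hw
  exact (hn.subperm h).length_le

/-- Two output words whose concatenation is `u u`, up to doubling letters, are both copies of `u`,
up to doubling letters. -/
theorem append_eq_of_dup {u U₁ U₂ w₁ w₂ : List A} (hu : u.Nodup) (h2 : 2 ≤ u.length)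
    (h₁ : U₁ = u ∨ Dup U₁ u) (h₂ : U₂ = u ∨ Dup U₂ u)
    (h : sweep w₁ [] ++ sweep w₂ [] = U₁ ++ U₂) :
    sweep w₁ [] = U₁ ∧ sweep w₂ [] = U₂ := by
  obtain ⟨y, m, z, rfl⟩ : ∃ y m z, u = y :: (m ++ [z]) := by
    rcases u with _ | ⟨y, u⟩
    · simp at h2
    · rcases List.eq_nil_or_concat u with rfl | ⟨m, z, rfl⟩
      · simp at h2
      · exact ⟨y, m, z, by simp⟩
  have hyz : y ≠ z := by rintro rfl; simp at hu
  have hyzu : [y, z].Sublist (y :: (m ++ [z])) := by simp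
  have sub₁ : (y :: (m ++ [z])).Sublist U₁ := by
    rcases h₁ with rfl | h₁
    exacts [List.Sublist.refl _, h₁.sublist]
  have sub₂ : (y :: (m ++ [z])).Sublist U₂ := by
    rcases h₂ with rfl | h₂
    exacts [List.Sublist.refl _, h₂.sublist]
  have last₁ : U₁.getLast? = some z := by
    rcases h₁ with rfl | h₁
    · simp [List.getLast?_cons]
    · rw [h₁.getLast?]; simp [List.getLast?_cons]
  have last₂ : U₂.getLast? = some z := by
    rcases h₂ with rfl | h₂
    · simp [List.getLast?_cons]
    · rw [h₂.getLast?]; simp [List.getLast?_cons]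
  have head₂ : U₂.head? = some y := by
    rcases h₂ with rfl | h₂
    · simp
    · rw [h₂.head?]; simp
  have mem₂ : ∀ d ∈ U₂, d ∈ y :: (m ++ [z]) := by
    rcases h₂ with rfl | h₂
    · exact fun _ => id
    · exact fun d => h₂.mem_iff.1
  rcases List.append_eq_append_iff.1 h with ⟨e, he₁, he₂⟩ | ⟨e, he₁, he₂⟩
  · rcases List.eq_nil_or_concat' e with rfl | ⟨e₀, d, rfl⟩
    · exact ⟨by simpa using he₁.symm, by simpa using he₂⟩
    -- If the cut comes too early, the second output contains the final `z` of `U₁`, then `y`, then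
    -- its own last letter `z`. The last letter of an output is clumped, a contradiction.
    exfalso
    have hz : z ∈ e₀ ++ [d] := by
      have := last₁
      rw [he₁, ← List.append_assoc, List.getLast?_concat] at this
      simp at this
      simp [this]
    obtain ⟨U, rfl⟩ := List.getLast?_eq_some_iff.1 last₂
    have hc := clump_last_sweep (w := w₂) (l := (e₀ ++ [d]) ++ U) (z := z) (by rw [he₂]; simp)
    rw [he₂] at hc
    exact hyz (hc y ((List.singleton_sublist.2 hz).append (hyzu.trans sub₂)))
  · rcases List.eq_nil_or_concat' e with rfl | ⟨e₀, d, rfl⟩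
    · exact ⟨by simpa using he₁, by simpa using he₂.symm⟩
    -- If the cut comes too late, the last letter `d` of the first output also occurs inside `U₁`,
    -- with another letter in between: the initial `y` of `U₂` if `d = z`, and the `z` of `U₁`
    -- otherwise.
    exfalso
    have hc := clump_last_sweep (w := w₁) (l := U₁ ++ e₀) (z := d) (by rw [he₁]; simp)
    rw [he₁] at hc
    have hd : d ∈ y :: (m ++ [z]) := mem₂ d (by rw [he₂]; simp)
    by_cases hdz : d = z
    · subst hdz
      refine hyz (hc y ?_)
      have h1 : [d].Sublist U₁ := (List.singleton_sublist.2 hd).trans sub₁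
      refine h1.append ?_
      rcases e₀ with _ | ⟨y', e₀⟩
      · rw [he₂] at head₂
        simp at head₂
        exact absurd head₂.symm hyz
      · rw [he₂] at head₂
        simp at head₂
        simp [head₂]
    · refine hdz (hc z ?_).symm
      have h1 : [d, z].Sublist U₁ := by
        refine List.Sublist.trans ?_ sub₁
        have : d ∈ y :: m := by simpa [hdz] using hd
        simpa using (List.singleton_sublist.2 this).append (List.Sublist.refl [z])
      exact h1.append (List.singleton_sublist.2 (by simp : d ∈ e₀ ++ [d]))

theorem peel_two {x : A} {w₁ w₂ : List A} (h₁ : x ∉ w₁) (h₂ : x ∉ w₂) :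
    peel (x :: (w₁ ++ x :: w₂)) = sweep w₁ [] ++ sweep w₂ [] := by
  have e₁ : (sweep w₁ []).filter (fun z => some z ≠ some x) = sweep w₁ [] := by
    rw [List.filter_eq_self]; rintro z hz; rw [mem_sweep] at hz; simp; rintro rfl; exact h₁ hz
  have e₂ : (sweep w₂ []).filter (fun z => some z ≠ some x) = sweep w₂ [] := by
    rw [List.filter_eq_self]; rintro z hz; rw [mem_sweep] at hz; simp; rintro rfl; exact h₂ hz
  rw [peel, sweep_two h₁ h₂, List.head?_cons, List.filter_append, List.filter_append, e₁, e₂]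
  simp

theorem peel_three {x : A} {w₁ w₂ w₃ : List A} (h₁ : x ∉ w₁) (h₂ : x ∉ w₂) (h₃ : x ∉ w₃) :
    peel (x :: (w₁ ++ x :: (w₂ ++ x :: w₃))) = sweep w₁ [] ++ (sweep w₂ [] ++ sweep w₃ []) := by
  have e₁ : (sweep w₁ []).filter (fun z => some z ≠ some x) = sweep w₁ [] := by
    rw [List.filter_eq_self]; rintro z hz; rw [mem_sweep] at hz; simp; rintro rfl; exact h₁ hz
  have e₂ : (sweep w₂ []).filter (fun z => some z ≠ some x) = sweep w₂ [] := by
    rw [List.filter_eq_self]; rintro z hz; rw [mem_sweep] at hz; simp; rintro rfl; exact h₂ hz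
  have e₃ : (sweep w₃ []).filter (fun z => some z ≠ some x) = sweep w₃ [] := by
    rw [List.filter_eq_self]; rintro z hz; rw [mem_sweep] at hz; simp; rintro rfl; exact h₃ hz
  rw [peel, sweep_three h₁ h₂ h₃, List.head?_cons, List.filter_append, List.filter_append,
    List.filter_append, e₁, e₂, e₃]
  simp

theorem exists_split_of_count_succ {x : A} {w : List A} {n : ℕ} (h : w.count x = n + 1) :
    ∃ w₁ w₂, w = w₁ ++ x :: w₂ ∧ x ∉ w₁ ∧ w₂.count x = n := by
  have : x ∈ w := List.count_pos_iff.1 (by omega)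
  obtain ⟨w₁, w₂, rfl, hw⟩ := List.eq_append_cons_of_mem this
  refine ⟨w₁, w₂, rfl, hw, ?_⟩
  rw [List.count_append, List.count_cons_self, List.count_eq_zero_of_not_mem hw] at h
  omega

theorem eq_reverse_of_sweep {w v : List A} (hw : w.Nodup) (h : sweep w [] = v) :
    w = v.reverse := by
  rw [← h, sweep_of_nodup hw, List.reverse_reverse]

/-- A tight word in which every letter occurs twice is the square of a word. -/
theorem Tight.eq_append_self (n : ℕ) : ∀ q : List A, q.length ≤ n → Tight q →
    (∀ z ∈ q, q.count z = 2) → ∃ v, v.Nodup ∧ q = v ++ v := by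
  induction n with
  | zero =>
    intro q hq _ _
    exact ⟨[], by simp, by simpa using hq⟩
  | succ n ih =>
    intro q hq ht hc
    rcases q with _ | ⟨x, w⟩
    · exact ⟨[], by simp, rfl⟩
    have hx : w.count x = 0 + 1 := by simpa using hc x (by simp)
    obtain ⟨w₁, w₂, rfl, h₁, h₂⟩ := exists_split_of_count_succ hx
    rw [List.count_eq_zero] at h₂
    have hp := peel_two h₁ h₂
    obtain ⟨v, hv, hvv⟩ := ih _ (by
      rw [hp, List.length_append, (sweep_perm _ _).length_eq, (sweep_perm _ _).length_eq]
      simp at hq ⊢; omega) ht.peel (by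
      rw [hp]
      intro z hz
      simp only [List.mem_append, mem_sweep] at hz
      have hzx : x ≠ z := by rintro rfl; exact hz.elim h₁ h₂
      have := hc z (by simp; tauto)
      simpa [List.count_append, count_sweep, List.count_cons, hzx] using this)
    rw [hp] at hvv
    have hmem : ∀ z ∈ sweep w₁ [] ++ sweep w₂ [], z ∈ v := by rw [hvv]; simp
    have hxv : x ∉ v := by
      intro hxv
      have : x ∈ sweep w₁ [] ++ sweep w₂ [] := by rw [hvv]; simp [hxv]
      simp only [List.mem_append, mem_sweep] at this
      exact this.elim h₁ h₂
    have hnd : w₁.Nodup ∧ w₂.Nodup := by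
      -- Short `v` is separate because `z z` is itself a doubling. There both letters `z` in one gap
      -- would make `z` clumped.
      rcases Nat.lt_or_ge v.length 2 with hlt | hge
      · rcases v with _ | ⟨z, _ | ⟨z', v⟩⟩
        · simp at hvv
          have e₁ := (sweep_perm w₁ []).length_eq
          have e₂ := (sweep_perm w₂ []).length_eq
          simp [hvv] at e₁ e₂
          simp [List.eq_nil_of_length_eq_zero e₁.symm, List.eq_nil_of_length_eq_zero e₂.symm]
        · have hzx : z ≠ x := by rintro rfl; simp at hxv
          have hp : (w₁ ++ w₂).Perm [z, z] := by
            have h := ((sweep_perm w₁ []).append (sweep_perm w₂ [])).symm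
            rw [hvv] at h
            simpa using h
          have hr : w₁ ++ w₂ = [z, z] := by
            have := List.perm_replicate (n := 2) (a := z) (l := w₁ ++ w₂)
            exact this.1 hp
          have hnc := not_clump_of_tight ht (y := x) (z := z) (by simp)
            (by have : z ∈ w₁ ++ w₂ := by rw [hr]; simp
                simp at this ⊢; tauto) (Ne.symm hzx)
          rcases w₁ with _ | ⟨a, _ | ⟨b, w₁⟩⟩
          · exfalso
            simp at hr
            subst hr
            exact hnc (clump_append_replicate (x := z) (l := [x, x]) (by simpa using hzx) 2)
          · simp at hr
            simp [hr]
          · exfalso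
            simp at hr
            obtain ⟨rfl, rfl, rfl, rfl⟩ := hr
            exact hnc (Clump.append_right (l := [x] ++ List.replicate 2 b)
              (clump_append_replicate (by simpa using hzx) 2) (r := [x]) (by simpa using hzx))
        · simp at hlt
      · constructor
        · rcases nodup_or_dup_sweep w₁ with h | ⟨q, h⟩
          · exact h
          · exact absurd (hvv ▸ h.append_right (sweep w₂ [])) (not_dup_append_self hv hge)
        · rcases nodup_or_dup_sweep w₂ with h | ⟨q, h⟩
          · exact h
          · exact absurd (hvv ▸ h.append_left (sweep w₁ [])) (not_dup_append_self hv hge)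
    have l₁ := length_le_of_nodup_sweep hnd.1 (v := v) fun z hz => hmem z (by simp [hz])
    have l₂ := length_le_of_nodup_sweep hnd.2 (v := v) fun z hz => hmem z (by simp [hz])
    have hl := congrArg List.length hvv
    simp only [List.length_append] at hl
    obtain ⟨e₁, e₂⟩ := List.append_inj hvv (by omega)
    refine ⟨x :: v.reverse, by simp [hxv, hv], ?_⟩
    rw [eq_reverse_of_sweep hnd.1 e₁, eq_reverse_of_sweep hnd.2 e₂]
    simp

end

/-! ### The three families and the classification -/

/-- The word starting with `x`, containing `x` three times, that one pass turns into `v v x x x`,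
where the three gaps between the letters `x` produce `v[0..i)`, `v[i..] v[0..j)` and `v[j..]`. -/
def tripleHead (x : A) (v : List A) (i j : ℕ) : List A :=
  x :: ((v.take i).reverse ++ x :: ((v.drop i ++ v.take j).reverse ++ x :: (v.drop j).reverse))

/-- A word that one pass turns into `v` with its letter at position `k` doubled. -/
def undouble (v : List A) (k j : ℕ) : List A :=
  -- `(v.drop k).take 1` is the word consisting of letter `k` alone. The first `j` letters of `v`
  -- are ejected by its second occurrence; the letters between `j` and `k` are pushed afterwards.
  (v.drop (k + 1)).reverse ++ ((v.drop k).take 1 ++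
    (((v.take k).take j).reverse ++ ((v.drop k).take 1 ++ ((v.take k).drop j).reverse)))

/-- The word that one pass turns into `v u x x`, where `u` is a doubling of `v`. -/
def doubleRight (x : A) (v : List A) (k j : ℕ) : List A :=
  x :: (v.reverse ++ x :: undouble v k j)

/-- The word that one pass turns into `u v x x`, where `u` is a doubling of `v`. -/
def doubleLeft (x : A) (v : List A) (k j : ℕ) : List A :=
  x :: (undouble v k j ++ x :: v.reverse)

theorem undouble_append (α β : List A) (c : A) (j : ℕ) :
    undouble (α ++ c :: β) α.length j =
      β.reverse ++ c :: ((α.take j).reverse ++ c :: (α.drop j).reverse) := by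
  have h : (α ++ c :: β).drop (α.length + 1) = β := by
    rw [← List.drop_drop]; simp
  simp [undouble, h]

theorem tripleHead_of_append_eq {v P₁ P₂ P₃ : List A} (h : P₁ ++ (P₂ ++ P₃) = v ++ v)
    (h₁ : P₁.length ≤ v.length) (h₂ : P₂.length ≤ v.length) (h₃ : P₃.length ≤ v.length) :
    ∃ i j, j ≤ i ∧ i ≤ v.length ∧ P₁ = v.take i ∧ P₂ = v.drop i ++ v.take j ∧ P₃ = v.drop j := by
  have hl := congrArg List.length h
  simp only [List.length_append] at hl
  -- Since the three lengths add up to `2 * v.length`, the bound on `P₂` is what gives `j ≤ i`.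
  refine ⟨P₁.length, v.length - P₃.length, by omega, h₁, ?_⟩
  have e₁ : P₁ = v.take P₁.length := by
    have := congrArg (List.take P₁.length) h
    rw [List.take_left, List.take_append_of_le_length h₁] at this
    exact this
  have e₃ : P₃ = v.drop (v.length - P₃.length) := by
    have := congrArg (List.drop (P₁ ++ P₂).length) h
    rw [← List.append_assoc, List.drop_left, List.drop_append] at this
    rw [List.drop_eq_nil_of_le (by simp; omega), List.nil_append] at this
    rw [this, List.length_append]
    congr 1
    simp only [List.length_drop]
    omega
  refine ⟨e₁, ?_, e₃⟩
  have h' : P₁ ++ (P₂ ++ P₃) = P₁ ++ ((v.drop P₁.length ++ v.take (v.length - P₃.length)) ++ P₃) := by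
    rw [h]
    conv_rhs => rw [List.append_assoc, ← List.append_assoc P₁]
    conv_rhs => enter [1, 1]; rw [e₁]
    conv_rhs => enter [2, 2]; rw [e₃]
    rw [List.take_append_drop, List.take_append_drop]
  exact List.append_cancel_right (List.append_cancel_left h')

section

variable [DecidableEq A]

/-- The excesses `count - 2` add up to one. -/
theorem exists_count_three {p : List A} (hlen : p.length = 2 * p.toFinset.card + 1)
    (h2 : ∀ z ∈ p, 2 ≤ p.count z) :
    ∃ b ∈ p, p.count b = 3 ∧ ∀ z ∈ p, z ≠ b → p.count z = 2 := by
  have hs : ∑ z ∈ p.toFinset, (p.count z - 2) = 1 := by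
    have h1 : ∑ z ∈ p.toFinset, (p.count z - 2 + 2) = p.length := by
      rw [← List.sum_toFinset_count_eq_length]
      refine Finset.sum_congr rfl fun z hz => ?_
      have := h2 z (by simpa using hz)
      omega
    rw [Finset.sum_add_distrib] at h1
    simp at h1
    omega
  obtain ⟨b, hb, hb0⟩ := Finset.exists_ne_zero_of_sum_ne_zero (by rw [hs]; simp)
  rw [← Finset.add_sum_erase _ _ hb] at hs
  refine ⟨b, by simpa using hb, by omega, fun z hz hzb => ?_⟩
  have h0 : ∑ z ∈ p.toFinset.erase b, (p.count z - 2) = 0 := by omega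
  rw [Finset.sum_eq_zero_iff] at h0
  have := h0 z (by simp [hz, hzb])
  have := h2 z hz
  omega

theorem two_le_count_of_not_clump {z : A} {p : List A} (h : ¬ Clump z p) : 2 ≤ p.count z := by
  simp only [Clump, not_forall] at h
  obtain ⟨y, hy, hne⟩ := h
  have := hy.count_le z
  simp [hne] at this
  exact this

theorem three_le_count_of_not_clump {z : A} {l r : List A} (h : ¬ Clump z (l ++ z :: z :: r)) :
    3 ≤ (l ++ z :: z :: r).count z := by
  by_contra hlt
  simp [List.count_append] at hlt
  have hl : z ∉ l := List.count_eq_zero.1 (by omega)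
  have hr : z ∉ r := List.count_eq_zero.1 (by omega)
  refine h ?_
  have := Clump.append_right (clump_append_replicate hl 2) hr
  simpa [List.replicate] using this

theorem sweep_undouble {δ ε ζ : List A} {c : A} (hn : (δ ++ ε ++ ζ).Nodup)
    (hc : c ∉ δ ++ ε ++ ζ) :
    sweep (δ ++ c :: (ε ++ c :: ζ)) [] =
      ε.reverse ++ (ζ.reverse ++ c :: c :: δ.reverse) := by
  simp only [List.mem_append, not_or] at hc
  obtain ⟨⟨hδ, hε⟩, hζ⟩ := hc
  rw [List.nodup_append, List.nodup_append] at hn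
  obtain ⟨⟨nδ, nε, hδε⟩, nζ, hζ'⟩ := hn
  rw [sweep_append_of_nodup _ _ _ nδ (by simp), List.append_nil,
    sweep_cons_notMem _ (by simpa using hδ)]
  have h1 := sweep_append_cons (x := c) ζ δ.reverse ε [] hε (by simp)
    (fun z hz hz' => hδε z (by simpa using hz') z hz rfl)
  rw [List.nil_append] at h1
  have h2 := sweep_append_of_nodup [] ζ (c :: c :: δ.reverse) nζ (by
    intro z hz
    simp only [List.mem_cons, List.mem_reverse, not_or]
    have : z ≠ c := fun e => hζ (e ▸ hz)
    exact ⟨this, this, fun hz' => hζ' z (by simp [hz']) z hz rfl⟩)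
  rw [List.append_nil] at h2
  rw [h1, h2, sweep_of_nodup nε]
  rfl

theorem sweep_undouble_append {α β : List A} {c : A} (hn : (α ++ c :: β).Nodup) (j : ℕ) :
    sweep (undouble (α ++ c :: β) α.length j) [] = α ++ c :: c :: β := by
  have hp : (β.reverse ++ (α.take j).reverse ++ (α.drop j).reverse).Perm (α ++ β) := by
    rw [List.append_assoc]
    refine ((β.reverse_perm).append ?_).trans List.perm_append_comm
    have := ((α.take j).reverse_perm).append ((α.drop j).reverse_perm)
    rwa [List.take_append_drop] at this
  rw [List.nodup_middle, List.nodup_cons] at hn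
  rw [undouble_append, sweep_undouble (hp.nodup_iff.2 hn.2) (fun h => hn.1 (hp.mem_iff.1 h))]
  simp only [List.reverse_reverse]
  rw [← List.append_assoc, List.take_append_drop]

/-- Write the preimage as `δ c ε c ζ`. Its output is computed by `sweep_undouble`, and comparing
around the first `c` leaves only the length of `ε` free. -/
theorem eq_undouble_of_sweep {w α β : List A} {c : A} (hn : (α ++ c :: β).Nodup)
    (h : sweep w [] = α ++ c :: c :: β) :
    ∃ j ≤ α.length, w = undouble (α ++ c :: β) α.length j := by
  rw [List.nodup_middle, List.nodup_cons] at hn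
  simp only [List.mem_append, not_or] at hn
  obtain ⟨⟨hα, hβ⟩, hn⟩ := hn
  have hcount : w.count c = 1 + 1 := by
    rw [← count_sweep, h]
    simp [List.count_append, List.count_eq_zero_of_not_mem, hα, hβ]
  obtain ⟨δ, w, rfl, hδ, hcount⟩ := exists_split_of_count_succ hcount
  obtain ⟨ε, ζ, rfl, hε, hζ⟩ := exists_split_of_count_succ (n := 0) hcount
  rw [List.count_eq_zero] at hζ
  have hc : c ∉ δ ++ ε ++ ζ := by simp [*]
  have hp : (δ ++ ε ++ ζ).Perm (α ++ β) := by
    rw [List.perm_iff_count]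
    intro z
    have := count_sweep z (δ ++ c :: (ε ++ c :: ζ))
    rw [h] at this
    simp only [List.count_append, List.count_cons] at this ⊢
    omega
  rw [sweep_undouble (hp.nodup_iff.2 hn) hc, ← List.append_assoc] at h
  obtain ⟨rfl, hδβ⟩ := append_cons_inj_left (by simp [*]) hα h
  simp only [List.cons.injEq, true_and] at hδβ
  subst hδβ
  refine ⟨ε.length, by simp, ?_⟩
  rw [undouble_append]
  simp

theorem Tight.classify {p : List A} {N : ℕ} (hN : 3 ≤ N) (hcard : p.toFinset.card = N)
    (hlen : p.length = 2 * N + 1) (ht : Tight p) :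
    ∃ x v, (x :: v).Nodup ∧ v.length + 1 = N ∧
      ((∃ i j, j ≤ i ∧ i ≤ v.length ∧ p = tripleHead x v i j) ∨
        (∃ k j, j ≤ k ∧ k < v.length ∧ p = doubleRight x v k j) ∨
        (∃ k j, j ≤ k ∧ k < v.length ∧ p = doubleLeft x v k j)) := by
  have hnc : ∀ z ∈ p, ¬ Clump z p := by
    intro z hz
    obtain ⟨y, hy, hyz⟩ := Finset.exists_mem_ne (s := p.toFinset) (by omega) z
    exact not_clump_of_tight ht (by simpa using hy) hz hyz
  obtain ⟨b, hbp, hb3, hb2⟩ := exists_count_three (by rw [hcard]; exact hlen)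
    fun z hz => two_le_count_of_not_clump (hnc z hz)
  rcases p with _ | ⟨x, w⟩
  · simp at hlen
  -- If the threefold letter comes first, peeling removes it and leaves a word with every letter
  -- occurring twice, hence a square. Otherwise it survives the peeling.
  by_cases hbx : b = x
  · subst hbx
    rw [List.count_cons_self] at hb3
    obtain ⟨w₁, w, rfl, h₁, hw⟩ := exists_split_of_count_succ (n := 1) (by omega : w.count b = 1 + 1)
    obtain ⟨w₂, w₃, rfl, h₂, h₃⟩ := exists_split_of_count_succ (n := 0) hw
    rw [List.count_eq_zero] at h₃
    have hp := peel_three h₁ h₂ h₃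
    obtain ⟨v, hv, hvv⟩ := Tight.eq_append_self _ _ le_rfl ht.peel (by
      rw [hp]
      intro z hz
      simp only [List.mem_append, mem_sweep] at hz
      have hzx : b ≠ z := by rintro rfl; tauto
      have := hb2 z (by simp; tauto) (Ne.symm hzx)
      simpa [List.count_append, count_sweep, List.count_cons, hzx] using this)
    rw [hp] at hvv
    have hlv := congrArg List.length hvv
    simp [(sweep_perm _ _).length_eq] at hlv hlen
    have hmem : ∀ z ∈ sweep w₁ [] ++ (sweep w₂ [] ++ sweep w₃ []), z ∈ v := by rw [hvv]; simp
    have hbv : b ∉ v := by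
      intro hbv
      have : b ∈ sweep w₁ [] ++ (sweep w₂ [] ++ sweep w₃ []) := by rw [hvv]; simp [hbv]
      simp only [List.mem_append, mem_sweep] at this
      tauto
    have hnd : ∀ q, ¬ Dup (v ++ v) q := fun q => not_dup_append_self hv (by omega)
    have n₁ : w₁.Nodup := (nodup_or_dup_sweep w₁).resolve_right fun ⟨q, h⟩ =>
      hnd _ (hvv ▸ h.append_right _)
    have n₂ : w₂.Nodup := (nodup_or_dup_sweep w₂).resolve_right fun ⟨q, h⟩ =>
      hnd _ (hvv ▸ (h.append_right _).append_left _)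
    have n₃ : w₃.Nodup := (nodup_or_dup_sweep w₃).resolve_right fun ⟨q, h⟩ =>
      hnd _ (hvv ▸ (h.append_left _).append_left _)
    obtain ⟨i, j, hji, hi, e₁, e₂, e₃⟩ := tripleHead_of_append_eq hvv
      (length_le_of_nodup_sweep n₁ fun z hz => hmem z (by simp [hz]))
      (length_le_of_nodup_sweep n₂ fun z hz => hmem z (by simp [hz]))
      (length_le_of_nodup_sweep n₃ fun z hz => hmem z (by simp [hz]))
    refine ⟨b, v, by simp [hbv, hv], by omega, Or.inl ⟨i, j, hji, hi, ?_⟩⟩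
    rw [tripleHead, ← eq_reverse_of_sweep n₁ e₁, ← eq_reverse_of_sweep n₂ e₂,
      ← eq_reverse_of_sweep n₃ e₃]
  · have hx2 := hb2 x (by simp) (Ne.symm hbx)
    rw [List.count_cons_self] at hx2
    obtain ⟨w₁, w₂, rfl, h₁, h₂⟩ := exists_split_of_count_succ (n := 0) (by omega : w.count x = 0 + 1)
    rw [List.count_eq_zero] at h₂
    have hp := peel_two h₁ h₂
    have htq := ht.peel
    rw [hp] at htq
    have hcq : ∀ z, z ≠ x → (sweep w₁ [] ++ sweep w₂ []).count z =
        (x :: (w₁ ++ x :: w₂)).count z := by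
      intro z hz
      simp [List.count_append, count_sweep, Ne.symm hz]
    have hmem : ∀ z, z ∈ sweep w₁ [] ++ sweep w₂ [] ↔ z ∈ x :: (w₁ ++ x :: w₂) ∧ z ≠ x := by
      intro z
      simp only [List.mem_append, mem_sweep, List.mem_cons]
      constructor
      · intro h
        refine ⟨by tauto, ?_⟩
        rintro rfl
        tauto
      · tauto
    -- Three letters `b` lie in two gaps, so one gap has a repetition and its output has equal
    -- neighbours.
    obtain ⟨q, hq⟩ : ∃ q, Dup (sweep w₁ [] ++ sweep w₂ []) q := by
      rcases nodup_or_dup_sweep w₁ with n₁ | ⟨q, h⟩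
      · rcases nodup_or_dup_sweep w₂ with n₂ | ⟨q, h⟩
        · exfalso
          have := hcq b hbx
          rw [hb3, List.count_append, count_sweep, count_sweep] at this
          have := List.nodup_iff_count_le_one.1 n₁ b
          have := List.nodup_iff_count_le_one.1 n₂ b
          omega
        · exact ⟨_, h.append_left _⟩
      · exact ⟨_, h.append_right _⟩
    have hqt := hq.tight htq
    have hq' := hq
    obtain ⟨l, c, r, e, rfl⟩ := hq
    have hcm := (hmem c).1 (by rw [e]; simp)
    -- An adjacent pair of a letter occurring only twice would be clumped, which tightness forbids.
    have hcb : c = b := by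
      by_contra hne
      have hc2 := hb2 c hcm.1 hne
      rw [← hcq c hcm.2, e] at hc2
      have hbm : b ∈ sweep w₁ [] ++ sweep w₂ [] := (hmem b).2 ⟨hbp, hbx⟩
      have := three_le_count_of_not_clump (z := c) (l := l) (r := r) (by
        rw [← e]
        exact not_clump_of_tight htq hbm ((hmem c).2 hcm) (Ne.symm hne))
      omega
    subst hcb
    obtain ⟨v, hv, hvv⟩ := Tight.eq_append_self _ _ le_rfl hqt (by
      intro z hz
      have hzm := (hmem z).1 (hq'.mem_iff.2 hz)
      by_cases hzc : z = c
      · have := hcq z hzm.2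
        rw [hzc, hb3, e] at this
        rw [hzc]
        simp [List.count_append] at this ⊢
        omega
      · have := hcq z hzm.2
        rw [hb2 z hzm.1 hzc, e] at this
        simpa [List.count_append, List.count_cons, Ne.symm hzc] using this)
    rw [hvv] at hq'
    have hl₁ := congrArg List.length e
    have hl₂ := congrArg List.length hvv
    simp [(sweep_perm _ _).length_eq] at hl₁ hl₂ hlen
    have hlv : v.length + 1 = N := by omega
    have hxv : x ∉ v := fun hxv => ((hmem x).1 (hq'.mem_iff.2 (by simp [hxv]))).2 rfl
    have hxvn : (x :: v).Nodup := by simp [hxv, hv]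
    refine ⟨x, v, hxvn, hlv, Or.inr ?_⟩
    obtain ⟨U, hU, hUv⟩ := dup_append_self_cases hq'
    rcases hUv with hUv | hUv
    · right
      obtain ⟨e₁, e₂⟩ := append_eq_of_dup hv (by omega) (Or.inr hU) (Or.inl rfl) hUv
      obtain ⟨α, d, β, rfl, rfl⟩ := hU
      obtain ⟨j, hj, hw₁⟩ := eq_undouble_of_sweep hv e₁
      have n₂ : w₂.Nodup := by
        have := (sweep_perm w₂ []).nodup_iff
        rw [e₂, List.append_nil] at this
        exact this.1 hv
      refine ⟨α.length, j, hj, by simp, ?_⟩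
      rw [doubleLeft, ← hw₁, ← eq_reverse_of_sweep n₂ e₂]
    · left
      obtain ⟨e₁, e₂⟩ := append_eq_of_dup hv (by omega) (Or.inl rfl) (Or.inr hU) hUv
      obtain ⟨α, d, β, rfl, rfl⟩ := hU
      obtain ⟨j, hj, hw₂⟩ := eq_undouble_of_sweep hv e₂
      have n₁ : w₁.Nodup := by
        have := (sweep_perm w₁ []).nodup_iff
        rw [e₁, List.append_nil] at this
        exact this.1 hv
      refine ⟨α.length, j, hj, by simp, ?_⟩
      rw [doubleRight, ← hw₂, ← eq_reverse_of_sweep n₁ e₁]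

end

/-! ### The families remain unsorted -/

theorem Dup.not_isSorted {p q : List A} (h : Dup p q) (hq : ¬ IsSorted q) : ¬ IsSorted p := by
  rw [isSorted_iff] at *
  exact fun hp => hq fun z => (hp z).sublist h.sublist

theorem numLetters_eq_card [DecidableEq A] (p : List A) : numLetters p = p.toFinset.card := by
  rw [numLetters, ← Set.ncard_coe_finset]
  congr 1
  ext
  simp

theorem Dup.length {p q : List A} (h : Dup p q) : p.length = q.length + 1 := by
  obtain ⟨l, b, r, rfl, rfl⟩ := h
  simp
  omega

theorem notMem_undouble {x : A} {v : List A} {k j : ℕ} (hx : x ∉ v) : x ∉ undouble v k j := by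
  intro h
  simp only [undouble, List.mem_append, List.mem_reverse] at h
  rcases h with h | h | h | h | h
  · exact hx (List.mem_of_mem_drop h)
  · exact hx (List.mem_of_mem_drop (List.mem_of_mem_take h))
  · exact hx (List.mem_of_mem_take (List.mem_of_mem_take h))
  · exact hx (List.mem_of_mem_drop (List.mem_of_mem_take h))
  · exact hx (List.mem_of_mem_take (List.mem_of_mem_drop h))

theorem exists_split_at {v : List A} {k : ℕ} (hk : k < v.length) :
    ∃ α c β, v = α ++ c :: β ∧ α.length = k :=
  ⟨v.take k, v[k], v.drop (k + 1), by simp, by simp; omega⟩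

theorem length_undouble {v : List A} {k j : ℕ} (hk : k < v.length) :
    (undouble v k j).length = v.length + 1 := by
  obtain ⟨α, c, β, rfl, rfl⟩ := exists_split_at hk
  rw [undouble_append]
  simp
  omega

section

variable [DecidableEq A]

theorem sweep_square {B t c E : List A} {y : A} (h : (B ++ (y :: t ++ (c ++ E))).Nodup) :
    sweep (B ++ (y :: t ++ (c ++ (y :: t ++ E)))) [] =
      c.reverse ++ (t.reverse ++ (E.reverse ++ (t.reverse ++ y :: y :: B.reverse))) := by
  simp only [List.nodup_append, List.cons_append, List.nodup_cons, List.mem_append,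
    List.mem_cons, not_or] at h
  obtain ⟨hB, ⟨⟨yt, yc, yE⟩, ht, ⟨hc, hE, hcE⟩, htcE⟩, hBt⟩ := h
  rw [sweep_append_of_nodup _ _ _ hB (by simp), List.append_nil, List.cons_append,
    sweep_cons_notMem _ (by simp; exact fun hy => hBt y hy y (by simp) rfl)]
  have h1 := sweep_append_cons (x := y) (t ++ E) B.reverse (t ++ c) [] (by simp [yt, yc]) (by simp)
    (by
      intro z hz hzB
      simp only [List.mem_append, List.mem_reverse] at hz hzB
      exact hBt z hzB z (by tauto) rfl)
  rw [List.nil_append] at h1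
  have h2 : (t ++ c).Nodup :=
    List.nodup_append.2 ⟨ht, hc, fun a ha b hb => htcE a ha b (Or.inl hb)⟩
  have h3 : (t ++ E).Nodup :=
    List.nodup_append.2 ⟨ht, hE, fun a ha b hb => htcE a ha b (Or.inr hb)⟩
  have h4 := sweep_append_of_nodup [] (t ++ E) (y :: y :: B.reverse) h3 (by
    intro z hz
    simp only [List.mem_append] at hz
    have hzy : z ≠ y := by rintro rfl; tauto
    simp only [List.mem_cons, List.mem_reverse, not_or]
    exact ⟨hzy, hzy, fun hzB => hBt z hzB z (by tauto) rfl⟩)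
  rw [List.append_nil] at h4
  rw [show t ++ (c ++ (y :: t ++ E)) = (t ++ c) ++ y :: (t ++ E) by simp, h1, h4, sweep_of_nodup h2]
  simp

/-- Up to a doubling, `sweep_square` turns `B T c T E` into a word of the same shape whose repeated
block has lost its first letter. Nonempty `c` and `E` keep the next separator and tail nonempty, and
a one-letter block around a nonempty `c` is unsorted. -/
theorem not_isSorted_iterate_square (k : ℕ) : ∀ B T c E : List A, T.length = k + 1 →
    (B ++ (T ++ (c ++ E))).Nodup → c ≠ [] → E ≠ [] →
      ¬ IsSorted ((fun p => sweep p [])^[k] (B ++ (T ++ (c ++ (T ++ E))))) := by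
  induction k with
  | zero =>
    intro B T c E hT hn hc _ hs
    obtain ⟨y, rfl⟩ := List.length_eq_one_iff.1 hT
    obtain ⟨d, c, rfl⟩ := List.exists_cons_of_ne_nil hc
    have := isSorted_iff.1 hs y d (by
      refine List.Sublist.trans ?_ (List.sublist_append_right _ _)
      simp)
    subst this
    simp [List.nodup_append] at hn
  | succ k ih =>
    intro B T c E hT hn hc hE
    obtain ⟨y, t, rfl⟩ := List.exists_cons_of_length_eq_add_one hT
    rw [Function.iterate_succ_apply, sweep_square hn]
    have hd : Dup (c.reverse ++ (t.reverse ++ (E.reverse ++ (t.reverse ++ y :: y :: B.reverse))))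
        (c.reverse ++ (t.reverse ++ (E.reverse ++ (t.reverse ++ y :: B.reverse)))) :=
      Dup.append_left (Dup.append_left (Dup.append_left ⟨_, y, _, rfl, rfl⟩ _) _) _
    refine (hd.iterate k).not_isSorted (ih _ _ _ _ (by simpa using hT) ?_ (by simpa using hE)
      (by simp))
    refine (List.Perm.nodup_iff ?_).1 hn
    rw [List.perm_iff_count]
    intro a
    simp [List.count_append, List.count_cons]
    omega

theorem not_isSorted_iterate_of_nodup {v : List A} {x : A} (hv : (x :: v).Nodup)
    (h2 : 2 ≤ v.length) :
    ¬ IsSorted ((fun p => sweep p [])^[v.length - 1] (v ++ (v ++ [x]))) := by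
  obtain ⟨y, t, rfl⟩ := List.exists_cons_of_ne_nil (l := v) (by rintro rfl; simp at h2)
  have hn : ([] ++ (y :: t ++ ([] ++ [x]))).Nodup := by
    rw [List.nil_append, List.nil_append, List.perm_append_comm.nodup_iff]
    exact hv
  have := sweep_square hn
  simp only [List.nil_append] at this
  obtain ⟨k, hk⟩ : ∃ k, t.length = k + 1 := ⟨t.length - 1, by simp at h2; omega⟩
  -- The two copies of `v` are adjacent at the start; one pass moves `x` between the repeated blocks
  -- and supplies the nonempty separator.
  rw [List.length_cons, Nat.add_sub_cancel, hk, Function.iterate_succ_apply, this]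
  have hd : Dup (t.reverse ++ ([x] ++ (t.reverse ++ [y, y])))
      (t.reverse ++ ([x] ++ (t.reverse ++ [y]))) :=
    Dup.append_left (Dup.append_left ⟨_, y, _, rfl, rfl⟩ _) _
  refine (hd.iterate k).not_isSorted
    (not_isSorted_iterate_square k [] t.reverse [x] [y] (by simpa using hk) ?_ (by simp) (by simp))
  refine (List.Perm.nodup_iff ?_).1 hv
  rw [List.perm_iff_count]
  intro a
  simp [List.count_append, List.count_cons]
  omega

theorem unsorted_of_sweep_dup {p q₁ q₂ v : List A} {x : A} (hv : (x :: v).Nodup)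
    (h2 : 2 ≤ v.length) (hp : sweep p [] = q₁) (h₁ : Dup q₁ q₂) (h₂ : Dup q₂ (v ++ (v ++ [x]))) :
    numLetters p = v.length + 1 ∧ p.length = 2 * (v.length + 1) + 1 ∧
      ¬ IsSorted ((fun p => sweep p [])^[v.length] p) := by
  refine ⟨?_, ?_, ?_⟩
  · rw [numLetters_eq_card, ← List.length_cons (a := x), ← List.toFinset_card_of_nodup hv]
    congr 1
    ext z
    rw [List.mem_toFinset, ← mem_sweep, hp, h₁.mem_iff, h₂.mem_iff]
    simp
    tauto
  · have := (sweep_perm p []).length_eq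
    rw [hp, h₁.length, h₂.length] at this
    simp at this
    omega
  · rw [show v.length = (v.length - 1) + 1 by omega, Function.iterate_succ_apply, hp]
    exact ((h₁.iterate _).not_isSorted
      ((h₂.iterate _).not_isSorted (not_isSorted_iterate_of_nodup hv h2)))

theorem unsorted_tripleHead {x : A} {v : List A} (hv : (x :: v).Nodup) (h2 : 2 ≤ v.length)
    {i j : ℕ} (hji : j ≤ i) :
    numLetters (tripleHead x v i j) = v.length + 1 ∧
      (tripleHead x v i j).length = 2 * (v.length + 1) + 1 ∧
      ¬ IsSorted ((fun p => sweep p [])^[v.length] (tripleHead x v i j)) := by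
  obtain ⟨hx, hn⟩ := List.nodup_cons.1 hv
  have hx₁ : x ∉ v.take i := fun h => hx (List.mem_of_mem_take h)
  have hx₂ : x ∉ v.drop i ++ v.take j := by
    rw [List.mem_append]
    exact fun h => hx (h.elim List.mem_of_mem_drop List.mem_of_mem_take)
  have hx₃ : x ∉ v.drop j := fun h => hx (List.mem_of_mem_drop h)
  have n₂ : (v.drop i ++ v.take j).Nodup := by
    have h1 : (v.drop i ++ v.take i).Nodup := by
      rw [List.perm_append_comm.nodup_iff, List.take_append_drop]; exact hn
    exact h1.sublist ((List.take_sublist_take_left hji).append_left _)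
  have hs : sweep (tripleHead x v i j) [] = v ++ (v ++ [x, x, x]) := by
    rw [tripleHead, sweep_three (by simpa using hx₁) (by rwa [List.mem_reverse]) (by simpa using hx₃),
      sweep_of_nodup (by simpa using hn.sublist (List.take_sublist i v)),
      sweep_of_nodup (List.nodup_reverse.2 n₂),
      sweep_of_nodup (by simpa using hn.sublist (List.drop_sublist j v))]
    simp only [List.reverse_reverse, List.append_assoc]
    rw [← List.append_assoc (v.take j), List.take_append_drop, ← List.append_assoc (v.take i),
      List.take_append_drop]
  exact unsorted_of_sweep_dup hv h2 hs (q₂ := v ++ (v ++ [x, x]))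
    ⟨v ++ v, x, [x], by simp, by simp⟩ ⟨v ++ v, x, [], by simp, by simp⟩

theorem unsorted_doubleRight {x : A} {v : List A} (hv : (x :: v).Nodup) (h2 : 2 ≤ v.length)
    {k j : ℕ} (hk : k < v.length) :
    numLetters (doubleRight x v k j) = v.length + 1 ∧
      (doubleRight x v k j).length = 2 * (v.length + 1) + 1 ∧
      ¬ IsSorted ((fun p => sweep p [])^[v.length] (doubleRight x v k j)) := by
  obtain ⟨hx, hn⟩ := List.nodup_cons.1 hv
  have hs := sweep_two (x := x) (w₁ := v.reverse) (w₂ := undouble v k j) (by simpa using hx)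
    (notMem_undouble hx)
  rw [sweep_of_nodup (List.nodup_reverse.2 hn), List.reverse_reverse] at hs
  obtain ⟨α, c, β, rfl, rfl⟩ := exists_split_at hk
  rw [sweep_undouble_append hn] at hs
  exact unsorted_of_sweep_dup hv h2 hs (q₂ := (α ++ c :: β) ++ ((α ++ c :: β) ++ [x, x]))
    ⟨(α ++ c :: β) ++ α, c, β ++ [x, x], by simp, by simp⟩
    ⟨(α ++ c :: β) ++ (α ++ c :: β), x, [], by simp, by simp⟩

theorem unsorted_doubleLeft {x : A} {v : List A} (hv : (x :: v).Nodup) (h2 : 2 ≤ v.length)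
    {k j : ℕ} (hk : k < v.length) :
    numLetters (doubleLeft x v k j) = v.length + 1 ∧
      (doubleLeft x v k j).length = 2 * (v.length + 1) + 1 ∧
      ¬ IsSorted ((fun p => sweep p [])^[v.length] (doubleLeft x v k j)) := by
  obtain ⟨hx, hn⟩ := List.nodup_cons.1 hv
  have hs := sweep_two (x := x) (w₂ := v.reverse) (w₁ := undouble v k j)
    (notMem_undouble hx) (by simpa using hx)
  rw [sweep_of_nodup (List.nodup_reverse.2 hn), List.reverse_reverse] at hs
  obtain ⟨α, c, β, rfl, rfl⟩ := exists_split_at hk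
  rw [sweep_undouble_append hn] at hs
  exact unsorted_of_sweep_dup hv h2 hs (q₂ := (α ++ c :: β) ++ ((α ++ c :: β) ++ [x, x]))
    ⟨α, c, β ++ ((α ++ c :: β) ++ [x, x]), by simp, by simp⟩
    ⟨(α ++ c :: β) ++ (α ++ c :: β), x, [], by simp, by simp⟩

/-- The output shows which letter is doubled, hence `k`; the distance between its two occurrences in
the word is governed by `j`. -/
theorem undouble_injective {v : List A} (hv : v.Nodup) {k j k' j' : ℕ} (hk : k < v.length)
    (hk' : k' < v.length) (hj : j ≤ k) (hj' : j' ≤ k')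
    (h : undouble v k j = undouble v k' j') : k = k' ∧ j = j' := by
  obtain ⟨α, c, β, rfl, rfl⟩ := exists_split_at hk
  obtain ⟨α', c', β', e, rfl⟩ := exists_split_at hk'
  have hs := congrArg (fun w => sweep w []) h
  simp only [sweep_undouble_append hv] at hs
  rw [e, sweep_undouble_append (e ▸ hv)] at hs
  have hcc : c = c' := by
    by_contra hne
    have h1 := congrArg (List.count c) hs
    have h2 := congrArg (List.count c) e
    simp [List.count_append, Ne.symm hne] at h1 h2
    omega
  subst hcc
  have hα : c ∉ α := fun h => (List.nodup_append.1 hv).2.2 c h c (by simp) rfl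
  have hα' : c ∉ α' := fun h => (List.nodup_append.1 (e ▸ hv)).2.2 c h c (by simp) rfl
  obtain ⟨rfl, rfl⟩ := append_cons_inj_left hα hα' e
  refine ⟨rfl, ?_⟩
  rw [undouble_append, undouble_append] at h
  simp only [List.append_cancel_left_eq, List.cons.injEq, true_and] at h
  have := (append_cons_inj_left (by simpa using fun h => hα (List.mem_of_mem_take h))
    (by simpa using fun h => hα (List.mem_of_mem_take h)) h).1
  have := congrArg List.length this
  simp at this
  omega

end

/-! ### Inequivalence of the family members, and counting -/

theorem map_undouble (f : A → A) (v : List A) (k j : ℕ) :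
    (undouble v k j).map f = undouble (v.map f) k j := by
  simp [undouble, List.map_take, List.map_drop]

theorem map_tripleHead (f : A → A) (x : A) (v : List A) (i j : ℕ) :
    (tripleHead x v i j).map f = tripleHead (f x) (v.map f) i j := by
  simp [tripleHead, List.map_take, List.map_drop]

theorem map_doubleRight (f : A → A) (x : A) (v : List A) (i j : ℕ) :
    (doubleRight x v i j).map f = doubleRight (f x) (v.map f) i j := by
  simp [doubleRight, map_undouble]

theorem map_doubleLeft (f : A → A) (x : A) (v : List A) (i j : ℕ) :
    (doubleLeft x v i j).map f = doubleLeft (f x) (v.map f) i j := by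
  simp [doubleLeft, map_undouble]

theorem split_of_map_eq {x : A} {w₁ w₂ w₁' w₂' : List A} {f : Equiv.Perm A} (hf : f x = x)
    (h₁ : x ∉ w₁) (h₁' : x ∉ w₁') (h : w₁' ++ x :: w₂' = (w₁ ++ x :: w₂).map f) :
    w₁' = w₁.map f ∧ w₂' = w₂.map f := by
  rw [List.map_append, List.map_cons, hf] at h
  refine append_cons_inj_left h₁' ?_ h
  intro hx
  obtain ⟨y, hy, hyx⟩ := List.mem_map.1 hx
  rw [← hf] at hyx
  exact h₁ (f.injective hyx ▸ hy)

theorem sum_range_succ_eq_choose (n : ℕ) : ∑ i ∈ Finset.range n, (i + 1) = (n + 1).choose 2 := by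
  induction n with
  | zero => rfl
  | succ n ih => rw [Finset.sum_range_succ, ih, Nat.choose_succ_succ' (n + 1) 1]; simp; omega

/-- The three families of words, on the letters `x` and `v`. -/
def family (x : A) (v : List A) :
    (Σ _ : ℕ, ℕ) ⊕ ((Σ _ : ℕ, ℕ) ⊕ (Σ _ : ℕ, ℕ)) → List A
  | .inl t => tripleHead x v t.1 t.2
  | .inr (.inl t) => doubleRight x v t.1 t.2
  | .inr (.inr t) => doubleLeft x v t.1 t.2

/-- The pairs `j ≤ i < n`. -/
def triangle (n : ℕ) : Finset (Σ _ : ℕ, ℕ) :=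
  (Finset.range n).sigma fun i => Finset.range (i + 1)

theorem mem_triangle {n : ℕ} {t : Σ _ : ℕ, ℕ} : t ∈ triangle n ↔ t.1 < n ∧ t.2 ≤ t.1 := by
  simp [triangle]

theorem card_triangle (n : ℕ) : (triangle n).card = (n + 1).choose 2 := by
  simp [triangle, Finset.card_sigma, sum_range_succ_eq_choose]

/-- All members start with `x`, so an equivalence between two of them fixes `x` and matches their
gaps. The number of letters `x` and the gap lengths separate the families, and the gap lengths also
determine `i` and `j` for `tripleHead`. In the other two families the gap `v.reverse` forces the
relabelling to fix `v`, and `undouble_injective` applies. -/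
theorem family_injOn {x : A} {v : List A} (hv : (x :: v).Nodup) :
    Set.InjOn (fun t => Quotient.mk (equivSetoid A) (family x v t))
      ((triangle (v.length + 1)).disjSum
        ((triangle v.length).disjSum (triangle v.length)) : Finset _) := by
  classical
  obtain ⟨hx, hn⟩ := List.nodup_cons.1 hv
  have hxr : x ∉ v.reverse := by simpa using hx
  have hxt : ∀ i, x ∉ (v.take i).reverse := fun i h =>
    hx (List.mem_of_mem_take (List.mem_reverse.1 h))
  have hxdt : ∀ i j, x ∉ (v.drop i ++ v.take j).reverse := fun i j h => by
    rw [List.mem_reverse, List.mem_append] at h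
    exact hx (h.elim List.mem_of_mem_drop List.mem_of_mem_take)
  have hxu : ∀ k j, x ∉ undouble v k j := fun k j => notMem_undouble hx
  have hmap : ∀ {f : Equiv.Perm A} {l : List A}, f x = x → x ∈ l.map f → x ∈ l := by
    intro f l hf h
    obtain ⟨y, hy, hyx⟩ := List.mem_map.1 h
    rw [← hf] at hyx
    exact f.injective hyx ▸ hy
  intro s hs t ht hst
  obtain ⟨f, hf⟩ : Equivalent (family x v s) (family x v t) := Quotient.exact hst
  have hfx : f x = x := by
    have := congrArg List.head? hf
    rcases s with s | s | s <;> rcases t with t | t | t <;>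
      simpa [family, tripleHead, doubleRight, doubleLeft, eq_comm] using this
  rcases s with ⟨i, j⟩ | ⟨i, j⟩ | ⟨i, j⟩ <;> rcases t with ⟨i', j'⟩ | ⟨i', j'⟩ | ⟨i', j'⟩ <;>
    simp only [Finset.mem_coe, Finset.inl_mem_disjSum, Finset.inr_mem_disjSum,
      mem_triangle] at hs ht <;>
    simp only [family, tripleHead, doubleRight, doubleLeft] at hf <;>
    rw [List.map_cons, List.cons.injEq] at hf <;>
    replace hf := hf.2
  · obtain ⟨h₁, h₂⟩ := split_of_map_eq hfx (hxt _) (hxt _) hf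
    obtain ⟨h₂, h₃⟩ := split_of_map_eq hfx (hxdt _ _) (hxdt _ _) h₂
    have l₁ := congrArg List.length h₁
    have l₂ := congrArg List.length h₂
    simp at l₁ l₂
    obtain rfl : i = i' := by omega
    obtain rfl : j = j' := by omega
    rfl
  · obtain ⟨-, h₂⟩ := split_of_map_eq hfx (hxt _) hxr hf
    exact absurd (h₂ ▸ List.mem_map.2 ⟨x, by simp, hfx⟩) (hxu i' j')
  · obtain ⟨-, h₂⟩ := split_of_map_eq hfx (hxt _) (hxu _ _) hf
    exact absurd (h₂ ▸ List.mem_map.2 ⟨x, by simp, hfx⟩) hxr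
  · obtain ⟨-, h₂⟩ := split_of_map_eq hfx hxr (hxt _) hf
    exact absurd (hmap hfx (h₂ ▸ by simp)) (hxu i j)
  · obtain ⟨h₁, h₂⟩ := split_of_map_eq hfx hxr hxr hf
    rw [List.map_reverse, List.reverse_inj] at h₁
    rw [map_undouble, ← h₁] at h₂
    obtain ⟨rfl, rfl⟩ := undouble_injective hn ht.1 hs.1 ht.2 hs.2 h₂
    rfl
  · obtain ⟨h₁, -⟩ := split_of_map_eq hfx hxr (hxu _ _) hf
    have := congrArg List.length h₁
    simp [length_undouble ht.1] at this
  · obtain ⟨-, h₂⟩ := split_of_map_eq hfx (hxu _ _) (hxt _) hf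
    exact absurd (hmap hfx (h₂ ▸ by simp)) hxr
  · obtain ⟨h₁, -⟩ := split_of_map_eq hfx (hxu _ _) hxr hf
    have := congrArg List.length h₁
    simp [length_undouble hs.1] at this
  · obtain ⟨h₁, h₂⟩ := split_of_map_eq hfx (hxu _ _) (hxu _ _) hf
    rw [List.map_reverse, List.reverse_inj] at h₂
    rw [map_undouble, ← h₂] at h₁
    obtain ⟨rfl, rfl⟩ := undouble_injective hn ht.1 hs.1 ht.2 hs.2 h₁
    rfl

theorem exists_nodup_length {N : ℕ} (hA : (N : ℕ∞) ≤ ENat.card A) :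
    ∃ l : List A, l.Nodup ∧ l.length = N := by
  rw [← Set.encard_univ] at hA
  obtain ⟨t, -, ht⟩ := Set.exists_subset_encard_eq hA
  have hfin : t.Finite := Set.finite_of_encard_eq_coe ht
  refine ⟨hfin.toFinset.toList, Finset.nodup_toList _, ?_⟩
  rw [hfin.encard_eq_coe_toFinset_card] at ht
  rw [Finset.length_toList]
  exact_mod_cast ht

end StackSort

theorem theorem2 {A : Type*} (N : ℕ) (hN : 3 ≤ N) (hA : (N : ℕ∞) ≤ ENat.card A)
    (a b : A) (hab : a ≠ b) :
    (Quotient.mk (StackSort.equivSetoid A) ''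
        {p : List A | StackSort.numLetters p = N ∧ p.length = 2 * N + 1 ∧
          ¬ StackSort.IsSorted ((StackSort.phi [a, b, a])^[N - 1] p)}).encard
      = (((N + 1).choose 2 + 2 * N.choose 2 : ℕ) : ℕ∞) := by
  classical
  open StackSort in
  obtain ⟨l, hl, hlen⟩ := exists_nodup_length hA
  obtain ⟨x, v, rfl⟩ := List.exists_cons_of_ne_nil (l := l) (by rintro rfl; simp at hlen; omega)
  rw [List.length_cons] at hlen
  have hphi : phi [a, b, a] = fun p => sweep p [] := funext (phi_eq_sweep hab)
  have hset : Quotient.mk (equivSetoid A) '' {p : List A | numLetters p = N ∧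
      p.length = 2 * N + 1 ∧ ¬ IsSorted ((phi [a, b, a])^[N - 1] p)} =
      (fun t => Quotient.mk (equivSetoid A) (family x v t)) ''
        ((triangle (v.length + 1)).disjSum
          ((triangle v.length).disjSum (triangle v.length)) : Finset _) := by
    rw [hphi]
    ext c
    constructor
    · rintro ⟨p, ⟨hp, hpl, hps⟩, rfl⟩
      rw [numLetters_eq_card] at hp
      have ht : Tight p := by
        have := tight_of_not_isSorted (N - 1) p.toFinset p (by omega)
          (fun z hz => clump_of_notMem (by simpa using hz)) hps
        rwa [List.filter_eq_self.2 (by simp)] at this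
      obtain ⟨x', v', hv', hlv, h⟩ := ht.classify hN hp hpl
      -- The classified word uses its own letters; relabelling moves it to the fixed letters `x ::
      -- v` without changing its indices.
      obtain ⟨f, hf⟩ := exists_perm_map_eq hv' hl (by simp; omega)
      rw [List.map_cons, List.cons.injEq] at hf
      have hvv : v'.length = v.length := by omega
      have key : ∀ t, p = family x' v' t → Quotient.mk (equivSetoid A) (family x v t) =
          Quotient.mk (equivSetoid A) p := by
        intro t ht
        symm
        refine Quotient.sound ⟨f, ?_⟩
        rw [ht]
        rcases t with t | t | t <;>
          simp only [family, map_tripleHead, map_doubleRight, map_doubleLeft, hf]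
      rcases h with ⟨i, j, h₁, h₂, h⟩ | ⟨i, j, h₁, h₂, h⟩ | ⟨i, j, h₁, h₂, h⟩
      · exact ⟨.inl ⟨i, j⟩, by simp [mem_triangle]; omega, key _ h⟩
      · exact ⟨.inr (.inl ⟨i, j⟩), by simp [mem_triangle]; omega, key _ h⟩
      · exact ⟨.inr (.inr ⟨i, j⟩), by simp [mem_triangle]; omega, key _ h⟩
    · rintro ⟨t, ht, rfl⟩
      refine ⟨_, ?_, rfl⟩
      rw [← hlen]
      rcases t with t | t | t <;>
        simp only [Finset.mem_coe, Finset.inl_mem_disjSum, Finset.inr_mem_disjSum,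
          mem_triangle] at ht
      · exact unsorted_tripleHead hl (by omega) ht.2
      · exact unsorted_doubleRight hl (by omega) ht.1
      · exact unsorted_doubleLeft hl (by omega) ht.1
  rw [hset, (family_injOn hl).encard_image, Set.encard_coe_eq_coe_finsetCard,
    Finset.card_disjSum, Finset.card_disjSum, card_triangle, card_triangle, hlen]
  congr 1
  ring
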